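/- **Setting.** Let $A\in\mathbb R^{n\times n}$, $B\in\mathbb R^{n\times m}$, let $Q\in\mathbb R^{n\times n}$ and $R\in\mathbb R^{m\times m}$ be symmetric positive definite, and suppose that $(A,B)$ is stabilizable, i.e. that $\mathcal G=\{K\in\mathbb R^{m\times n}: A-BK \text{ is Hurwitz}\}$ is nonempty. For $K\in\mathcal G$ let $P_K\succ0$ be the solution of $(A-BK)^\top P_K+P_K(A-BK)+Q+K^\top RK=0$ and put $J_2(K)=\operatorname{Tr}P_K$. Let $P^*\succ 0$ be the solution of $A^\top P^*+P^*A+Q-P^*BR^{-1}B^\top P^*=0$, let $K^*=R^{-1}B^\top P^*$, and let $Y^*\succ0$ be the solution of $(A-BK^*)Y^*+Y^*(A-BK^*)^\top+I=0$. Write $\|\cdot\|$ for the spectral norm, $\|\cdot\|_F$ for the Frobenius norm, $\langle K_1,K_2\rangle_Y=\operatorname{Tr}(K_1YK_2^\top)$, $\|W\|_\infty=\sup_k\|W(k)\|_F$, and $$c(K)=1+\|Y^*\|\,\|BR^{-1}B^\top\|\operatorname{Tr}(P_K).$$ **Algorithm.** Let $\eta(k)=\eta_k(K(k))$, where the functions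 $\eta_k:\mathcal G\to\mathbb R$ $(k\ge 0)$ satisfy $$0<\eta_k(K)\le\min\Big\{\frac1{2\|R\|},\frac1{6\|R\|c(K)}\Big\}\qquad(K\in\mathcal G,\ k\ge0)$$ and $\inf_{k\ge0,\,K\in C}\eta_k(K)>0$ for every nonempty compact $C\subset\mathcal G$ (the latter is automatic if $\eta_k=\eta$ does not depend on $k$ and is continuous on $\mathcal G$). Consider the perturbed natural policy gradient $$K(k+1)=K(k)-\eta(k)\big(2(RK(k)-B^\top P_{K(k)})+W(k)\big).\tag{1}$$ **Definitions.** A class $\mathcal K$ function is a continuous strictly increasing $\alpha:[0,\infty)\to[0,\infty)$ with $\alpha(0)=0$; class $\mathcal K_{[0,d)}$ is the same on $[0,d)$; $\beta:[0,\infty)^2\to[0,\infty)$ is of class $\mathcal{KL}$ if $\beta(\cdot,t)$ is of class $\mathcal K$ for each $t$ and $\beta(r,\cdot)$ is nonincreasing with limit $0$ for each $r$. A size function for $(\mathcal G,K^*)$ is a continuous $\mathcal V:\mathcal G\to[0,\infty)$ that vanishes exactly at $K^*$ and such that $\mathcal V(K_j)\to\infty$ whenever $K_j\in\mathcal G$ and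 $K_j\to\partial\mathcal G$ or $\|K_j\|_F\to\infty$. System (1) is *small-disturbance ISS with respect to $W$* if there are a size function $\mathcal V$ for $(\mathcal G,K^*)$, a $d\in(0,\infty]$, a $\mathcal{KL}$-function $\beta$ and a $\mathcal K_{[0,d)}$-function $\gamma$ such that for all $W$ with $\|W\|_\infty<d$ and all $K(0)\in\mathcal G$ the iterates remain in $\mathcal G$ and $$\mathcal V(K(k))\le\beta(\mathcal V(K(0)),k)+\gamma(\|W\|_\infty)\qquad\text{for all }k\ge0.$$ **Theorem.** System (1) is small-disturbance ISS with respect to $W$. Moreover $$\mathcal V_5(K)=\langle K-K^*,K-K^*\rangle_{Y^*}+J_2(K)-J_2(K^*)$$ is a small-disturbance ISS-Lyapunov function for it: $\mathcal V_5$ is a size function for $(\mathcal G,K^*)$, and there are a class $\mathcal K$ function $\alpha_1$ and a continuous positive definite function $\alpha_2:[0,\infty)\to[0,\infty)$ such that, for every $k\ge0$, every $K\in\mathcal G$ and every $W\in\mathbb R^{m\times n}$ with $\|W\|_F\le\alpha_1(\mathcal V_5(K))$, the gain $K_{\mathrm{next}}=K-\eta_k(K)\big(2(RK-B^\top P_K)+W\big)$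 lies in $\mathcal G$ and $\mathcal V_5(K_{\mathrm{next}})-\mathcal V_5(K)\le-\alpha_2(\mathcal V_5(K))$. -/

import Mathlib

open Filter Topology
open scoped Matrix ENNReal Matrix.Norms.Frobenius

/-! In this file the norm and the topology of a space of real matrices are those of the Frobenius
norm; the spectral norm is `spectralNorm2`. -/

/-! ### Comparison functions -/

/-- The interval `[0, d)` for `d ∈ (0, ∞]`. -/
def initialInterval (d : ℝ≥0∞) : Set ℝ := {r | 0 ≤ r ∧ ENNReal.ofReal r < d}

/-- `α : [0, d) → ℝ₊` is continuous, strictly increasing and vanishes at `0`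
(only the values of `α` on `[0, d)` matter). -/
def IsClassKOn (d : ℝ≥0∞) (α : ℝ → ℝ) : Prop :=
  ContinuousOn α (initialInterval d) ∧ StrictMonoOn α (initialInterval d) ∧ α 0 = 0

/-- Class `K`: functions on `ℝ₊ = [0, ∞)`. -/
def IsClassK (α : ℝ → ℝ) : Prop :=
  ContinuousOn α (Set.Ici 0) ∧ StrictMonoOn α (Set.Ici 0) ∧ α 0 = 0

/-- Class `KL`. -/
def IsClassKL (β : ℝ → ℝ → ℝ) : Prop :=
  (∀ t, 0 ≤ t → IsClassK (fun r => β r t)) ∧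
  (∀ r, 0 ≤ r → AntitoneOn (β r) (Set.Ici 0) ∧ Tendsto (β r) atTop (𝓝 0))

/-- Continuous and positive definite functions on `ℝ₊`. -/
def IsPosDefFun (α : ℝ → ℝ) : Prop :=
  ContinuousOn α (Set.Ici 0) ∧ α 0 = 0 ∧ ∀ r, 0 < r → 0 < α r

/-! ### Small-disturbance input-to-state stability -/

section ISS

variable {E U : Type*} [NormedAddCommGroup E] [NormedAddCommGroup U]

/-- The sequence `u` leaves the set `S`: it tends to the boundary of `S`, or its norm tends to
infinity. -/
def EscapesFrom (S : Set E) (u : ℕ → E) : Prop :=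
  ((frontier S).Nonempty ∧ Tendsto (fun k => Metric.infDist (u k) (frontier S)) atTop (𝓝 0)) ∨
    Tendsto (fun k => ‖u k‖) atTop atTop

/-- `V : S → ℝ₊` is a size function for `(S, x₀)`: continuous, positive definite with respect to
`x₀`, and coercive. -/
structure IsSizeFunction (S : Set E) (x₀ : E) (V : E → ℝ) : Prop where
  continuousOn : ContinuousOn V S
  mem : x₀ ∈ S
  eq_zero : V x₀ = 0
  pos : ∀ x ∈ S, x ≠ x₀ → 0 < V x
  coercive : ∀ u : ℕ → E, (∀ k, u k ∈ S) → EscapesFrom S u →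
    Tendsto (fun k => V (u k)) atTop atTop

/-- Small-disturbance ISS, with respect to the input `w`, of the system
`χ (k + 1) = f k (χ k) (w k)` with state set `S` and equilibrium `x₀`. A time-invariant system is
the case in which `f` does not depend on its first argument. -/
def IsSmallDisturbanceISS (S : Set E) (x₀ : E) (f : ℕ → E → U → E) : Prop :=
  ∃ V : E → ℝ, IsSizeFunction S x₀ V ∧
  ∃ d : ℝ≥0∞, 0 < d ∧
  ∃ β : ℝ → ℝ → ℝ, IsClassKL β ∧
  ∃ γ : ℝ → ℝ, IsClassKOn d γ ∧
    ∀ w : ℕ → U, BddAbove (Set.range fun k => ‖w k‖) → ENNReal.ofReal (⨆ k, ‖w k‖) < d →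
    ∀ χ : ℕ → E, χ 0 ∈ S → (∀ k, χ (k + 1) = f k (χ k) (w k)) →
    ∀ k : ℕ, χ k ∈ S ∧ V (χ k) ≤ β (V (χ 0)) (k : ℝ) + γ (⨆ j, ‖w j‖)

/-- `V` is a small-disturbance ISS-Lyapunov function of the system `χ (k + 1) = f k (χ k) (w k)`,
with a continuous positive definite decrease rate `α₂` that is the same for all times. -/
def IsSmallDisturbanceISSLyapunov (S : Set E) (x₀ : E) (f : ℕ → E → U → E) (V : E → ℝ) : Prop :=
  IsSizeFunction S x₀ V ∧
  ∃ α₁ α₂ : ℝ → ℝ, IsClassK α₁ ∧ IsPosDefFun α₂ ∧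
    ∀ (k : ℕ) (ξ : E) (μ : U), ξ ∈ S → ‖μ‖ ≤ α₁ (V ξ) →
      f k ξ μ ∈ S ∧ V (f k ξ μ) - V ξ ≤ - α₂ (V ξ)

end ISS

/-! ### The continuous-time linear quadratic regulator -/

noncomputable section LQR

/-- Every complex eigenvalue has a negative real part. -/
def IsHurwitz {n : ℕ} (F : Matrix (Fin n) (Fin n) ℝ) : Prop :=
  ∀ z ∈ spectrum ℂ (F.map (algebraMap ℝ ℂ)), z.re < 0

/-- The spectral norm of a square real matrix. -/
def spectralNorm2 {n : ℕ} (M : Matrix (Fin n) (Fin n) ℝ) : ℝ :=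
  ‖Matrix.toEuclideanCLM (n := Fin n) (𝕜 := ℝ) M‖

open Classical in
/-- The positive definite solution `X` of the Lyapunov equation `Fᵀ X + X F + M = 0`
(it exists and is unique when `F` is Hurwitz and `M` is positive definite). -/
def lyapunovSolution {n : ℕ} (F M : Matrix (Fin n) (Fin n) ℝ) : Matrix (Fin n) (Fin n) ℝ :=
  if h : ∃ X : Matrix (Fin n) (Fin n) ℝ, X.PosDef ∧ Fᵀ * X + X * F + M = 0 then h.choose else 0

variable {n m : ℕ} (A : Matrix (Fin n) (Fin n) ℝ) (B : Matrix (Fin n) (Fin m) ℝ)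
  (Q : Matrix (Fin n) (Fin n) ℝ) (R : Matrix (Fin m) (Fin m) ℝ)

/-- The set of stabilizing gains. -/
def stabilizingGains : Set (Matrix (Fin m) (Fin n) ℝ) := {K | IsHurwitz (A - B * K)}

open Classical in
/-- `P*`, the positive definite solution of the algebraic Riccati equation
(it exists and is unique when `(A, B)` is stabilizable and `Q`, `R` are positive definite). -/
def riccatiSolution : Matrix (Fin n) (Fin n) ℝ :=
  if h : ∃ P : Matrix (Fin n) (Fin n) ℝ,
      P.PosDef ∧ Aᵀ * P + P * A + Q - P * B * R⁻¹ * Bᵀ * P = 0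
  then h.choose else 0

/-- The optimal gain `K* = R⁻¹ Bᵀ P*`. -/
def optimalGain : Matrix (Fin m) (Fin n) ℝ := R⁻¹ * Bᵀ * riccatiSolution A B Q R

/-- `P_K`: `(A - B K)ᵀ P_K + P_K (A - B K) + Q + Kᵀ R K = 0`. -/
def costMatrix (K : Matrix (Fin m) (Fin n) ℝ) : Matrix (Fin n) (Fin n) ℝ :=
  lyapunovSolution (A - B * K) (Q + Kᵀ * R * K)

/-- The cost `J₂(K) = Tr P_K`. -/
def lqrCost (K : Matrix (Fin m) (Fin n) ℝ) : ℝ := (costMatrix A B Q R K).trace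

/-- `Y*`: `(A - B K*) Y* + Y* (A - B K*)ᵀ + I = 0`. -/
def optimalY : Matrix (Fin n) (Fin n) ℝ :=
  lyapunovSolution (A - B * optimalGain A B Q R)ᵀ 1

/-- `⟨K₁, K₂⟩_Y = Tr (K₁ Y K₂ᵀ)`. -/
def innerY (Y : Matrix (Fin n) (Fin n) ℝ) (K₁ K₂ : Matrix (Fin m) (Fin n) ℝ) : ℝ :=
  (K₁ * Y * K₂ᵀ).trace

/-- `c(K) = 1 + ‖Y*‖ ‖B R⁻¹ Bᵀ‖ Tr P_K`. -/
def stepConstant (K : Matrix (Fin m) (Fin n) ℝ) : ℝ :=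
  1 + spectralNorm2 (optimalY A B Q R) * spectralNorm2 (B * R⁻¹ * Bᵀ) *
    (costMatrix A B Q R K).trace

/-- One step, at time `k`, of the natural policy gradient with step size `η k K` at the gain `K`
and perturbation `W`. -/
def naturalGradientStep (η : ℕ → Matrix (Fin m) (Fin n) ℝ → ℝ) (k : ℕ)
    (K W : Matrix (Fin m) (Fin n) ℝ) : Matrix (Fin m) (Fin n) ℝ :=
  K - η k K • ((2 : ℝ) • (R * K - Bᵀ * costMatrix A B Q R K) + W)

/-- `⟨K - K*, K - K*⟩_{Y*} + J₂(K) - J₂(K*)`. -/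
def naturalLyapunov (K : Matrix (Fin m) (Fin n) ℝ) : ℝ :=
  innerY (optimalY A B Q R) (K - optimalGain A B Q R) (K - optimalGain A B Q R) +
    lqrCost A B Q R K - lqrCost A B Q R (optimalGain A B Q R)

end LQR

/-! Write `t` for the step size, `M = R K - Bᵀ P_K` and `E = K - K*`, so that the next gain is `L =
K - t (2 M + W)`. Two mechanisms work together.

Cost. In the Lyapunov equation of the closed loop of `L`, the matrix `P_K` leaves a residual. Once
`t R ≤ 1/2`, completing the square bounds it by `t ‖W‖² / 2` (`neg_forcing_eq`). If `Q ≥ q` and `t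
‖W‖² ≤ q`, then `P_K` certifies that `L` is stabilizing, and the comparison principle gives `P_L ≤
(1 + t ‖W‖² / q) P_K` (`naturalStep_costMatrix`). So the cost hardly grows, but no decrease rate is
drawn from it.

Distance. The rate comes from `⟨E, E⟩` in the `Y*` inner product. There `2 ⟨M, E⟩ = a`, where `a =
J₂(K) - J₂(K*) + ⟨R E, E⟩` (`two_mul_innerY_naturalGradient`), and `⟨M, M⟩ ≤ 2 ‖R‖ c(K) a`
(`innerY_naturalGradient_self_le`). The step-size bound lets the first-order gain dominate the
second-order loss, and `a` dominates a multiple of `V₅`. This yields `V₅(L) ≤ V₅(K) - t (ρ V₅(K) - c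
‖W‖²)` for small `W`.

Compactness of the cost sublevel sets gives coercivity, a minimiser (hence a Riccati solution), and
a positive lower bound for the step sizes in terms of `V₅`. With these, the decrease estimate
implies both claims by a scalar comparison argument. -/

namespace Matrix

/-! ### Real positive semidefinite matrices: order, trace and Frobenius norm. -/

section PosSemidef

variable {n m p : Type*} [Fintype n] [Fintype m] [Fintype p]

theorem posSemidef_real_iff {X : Matrix n n ℝ} :
    X.PosSemidef ↔ Xᵀ = X ∧ ∀ x, 0 ≤ x ⬝ᵥ (X *ᵥ x) := by
  simp [posSemidef_iff_dotProduct_mulVec, IsHermitian, conjTranspose_eq_transpose_of_trivial]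

theorem posDef_real_iff {X : Matrix n n ℝ} :
    X.PosDef ↔ Xᵀ = X ∧ ∀ x, x ≠ 0 → 0 < x ⬝ᵥ (X *ᵥ x) := by
  simp [posDef_iff_dotProduct_mulVec, IsHermitian, conjTranspose_eq_transpose_of_trivial]

theorem PosSemidef.transpose_eq {X : Matrix n n ℝ} (hX : X.PosSemidef) : Xᵀ = X :=
  (posSemidef_real_iff.1 hX).1

theorem PosDef.transpose_eq {X : Matrix n n ℝ} (hX : X.PosDef) : Xᵀ = X :=
  (posDef_real_iff.1 hX).1

theorem PosSemidef.transpose_mul_mul_same {X : Matrix n n ℝ} (hX : X.PosSemidef)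
    (Z : Matrix n m ℝ) : (Zᵀ * X * Z).PosSemidef := by
  simpa [conjTranspose_eq_transpose_of_trivial] using hX.conjTranspose_mul_mul_same Z

theorem PosSemidef.mul_mul_transpose_same {X : Matrix n n ℝ} (hX : X.PosSemidef)
    (Z : Matrix m n ℝ) : (Z * X * Zᵀ).PosSemidef := by
  simpa [conjTranspose_eq_transpose_of_trivial] using hX.mul_mul_conjTranspose_same Z

theorem posSemidef_transpose_mul_self (Z : Matrix m n ℝ) : (Zᵀ * Z).PosSemidef := by
  simpa [conjTranspose_eq_transpose_of_trivial] using posSemidef_conjTranspose_mul_self Z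

/-- The product of two positive semidefinite matrices has a nonnegative trace. -/
theorem PosSemidef.trace_mul_nonneg [DecidableEq n] {X Y : Matrix n n ℝ} (hX : X.PosSemidef)
    (hY : Y.PosSemidef) : 0 ≤ (X * Y).trace := by
  obtain ⟨k, v, rfl⟩ := posSemidef_iff_eq_sum_vecMulVec.1 hY
  simp only [Matrix.mul_sum, trace_sum, mul_vecMulVec, trace_vecMulVec]
  exact Finset.sum_nonneg fun i _ => by
    simpa [dotProduct_comm] using (posSemidef_real_iff.1 hX).2 (v i)

theorem PosSemidef.trace_mul_le_trace_mul [DecidableEq n] {X X' Y : Matrix n n ℝ}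
    (h : (X' - X).PosSemidef) (hY : Y.PosSemidef) : (X * Y).trace ≤ (X' * Y).trace := by
  have := h.trace_mul_nonneg hY
  rw [Matrix.sub_mul, trace_sub] at this
  linarith

theorem PosSemidef.trace_le_trace {X X' : Matrix n n ℝ} (h : (X' - X).PosSemidef) :
    X.trace ≤ X'.trace := by
  have := h.trace_nonneg
  rw [trace_sub] at this
  linarith

open MatrixOrder in
theorem PosSemidef.mul_of_commute [DecidableEq n] {X Y : Matrix n n ℝ} (hX : X.PosSemidef)
    (hY : Y.PosSemidef) (h : Commute X Y) : (X * Y).PosSemidef :=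
  nonneg_iff_posSemidef.1
    (Commute.mul_nonneg (nonneg_iff_posSemidef.2 hX) (nonneg_iff_posSemidef.2 hY) h)

/-- If `0 ≤ X ≤ t`, then `X² ≤ t X`. -/
theorem PosSemidef.smul_sub_mul_self [DecidableEq n] {X : Matrix n n ℝ} {t : ℝ}
    (hX : X.PosSemidef) (h : (t • (1 : Matrix n n ℝ) - X).PosSemidef) :
    (t • X - X * X).PosSemidef := by
  have := hX.mul_of_commute h
    (Commute.sub_right ((Commute.one_right X).smul_right t) (Commute.refl X))
  simpa [Matrix.mul_sub] using this

theorem frobenius_norm_sq_eq_trace (Z : Matrix m n ℝ) : ‖Z‖ ^ 2 = (Zᵀ * Z).trace := by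
  rw [frobenius_norm_def, ← Real.sqrt_eq_rpow, Real.sq_sqrt (by positivity)]
  simp only [trace, diag_apply, mul_apply, transpose_apply, Real.norm_eq_abs]
  rw [Finset.sum_comm]
  simp [sq]

theorem mulVec_dotProduct_mulVec (Z : Matrix m n ℝ) (x : n → ℝ) :
    (Z *ᵥ x) ⬝ᵥ (Z *ᵥ x) = x ⬝ᵥ ((Zᵀ * Z) *ᵥ x) := by
  rw [← mulVec_mulVec, dotProduct_mulVec x, vecMul_transpose]

/-- `Zᵀ Z ≤ ‖Z‖²` for the Frobenius norm. -/
theorem norm_sq_smul_one_sub_posSemidef [DecidableEq n] (Z : Matrix m n ℝ) :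
    ((‖Z‖ ^ 2) • (1 : Matrix n n ℝ) - Zᵀ * Z).PosSemidef := by
  refine posSemidef_real_iff.2 ⟨by simp, fun x => ?_⟩
  rw [sub_mulVec, dotProduct_sub, ← mulVec_dotProduct_mulVec, smul_mulVec, one_mulVec,
    dotProduct_smul, sub_nonneg, frobenius_norm_sq_eq_trace, smul_eq_mul]
  simp only [trace, diag_apply, mul_apply, transpose_apply]
  rw [Finset.sum_comm, Finset.sum_mul]
  refine Finset.sum_le_sum fun i _ => ?_
  have := Finset.sum_mul_sq_le_sq_mul_sq Finset.univ (Z i) x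
  simpa [mulVec, dotProduct, sq] using this

open MatrixOrder in
theorem PosSemidef.exists_eq_transpose_mul_self [DecidableEq n] {X : Matrix n n ℝ}
    (hX : X.PosSemidef) : ∃ Z : Matrix n n ℝ, X = Zᵀ * Z := by
  refine ⟨CFC.sqrt X, ?_⟩
  have h := CFC.sqrt_nonneg X
  rw [(nonneg_iff_posSemidef.1 h).transpose_eq]
  exact (CFC.sqrt_mul_sqrt_self X (nonneg_iff_posSemidef.2 hX)).symm

theorem PosSemidef.trace_smul_one_sub [DecidableEq n] {X : Matrix n n ℝ} (hX : X.PosSemidef) :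
    (X.trace • (1 : Matrix n n ℝ) - X).PosSemidef := by
  obtain ⟨Z, rfl⟩ := hX.exists_eq_transpose_mul_self
  rw [← frobenius_norm_sq_eq_trace]
  exact norm_sq_smul_one_sub_posSemidef Z

theorem PosSemidef.norm_le_trace [DecidableEq n] {X : Matrix n n ℝ} (hX : X.PosSemidef) :
    ‖X‖ ≤ X.trace := by
  refine abs_le_of_sq_le_sq' ?_ hX.trace_nonneg |>.2
  have := (hX.trace_smul_one_sub).trace_mul_le_trace_mul hX
  rw [frobenius_norm_sq_eq_trace, hX.transpose_eq]
  simpa [sq] using this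

/-- From `X⁻¹ ≤ t` follows `X⁻² ≤ t X⁻¹`, and congruence by `X` gives `1 ≤ t X`, so `q = t⁻¹` works.
The `+ 1` in `t` keeps it positive even in dimension zero. -/
theorem PosDef.exists_sub_smul_one_posSemidef [DecidableEq n] {X : Matrix n n ℝ} (hX : X.PosDef) :
    ∃ q > (0 : ℝ), (X - q • (1 : Matrix n n ℝ)).PosSemidef := by
  have hI := hX.inv.posSemidef
  set t := X⁻¹.trace + 1 with ht
  have ht0 : 0 < t := by have := hI.trace_nonneg; linarith
  have h1 : (t • (1 : Matrix n n ℝ) - X⁻¹).PosSemidef := by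
    convert hI.trace_smul_one_sub.add PosSemidef.one using 1
    rw [ht, add_smul, one_smul]; abel
  have h2 := (hI.smul_sub_mul_self h1).transpose_mul_mul_same X
  have hu : IsUnit X.det := (Matrix.isUnit_iff_isUnit_det X).1 hX.isUnit
  rw [hX.transpose_eq] at h2
  have h3 : X * (t • X⁻¹ - X⁻¹ * X⁻¹) * X = t • X - 1 := by
    simp [Matrix.mul_sub, Matrix.sub_mul, mul_nonsing_inv X hu, ← Matrix.mul_assoc]
    simp [nonsing_inv_mul X hu]
  rw [h3] at h2
  refine ⟨t⁻¹, inv_pos.2 ht0, ?_⟩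
  convert h2.smul (inv_nonneg.2 ht0.le) using 1
  rw [smul_sub, smul_smul, inv_mul_cancel₀ ht0.ne', one_smul]

theorem isClosed_setOf_posSemidef : IsClosed {X : Matrix n n ℝ | X.PosSemidef} := by
  simp only [posSemidef_real_iff, Set.ofPred_and, Set.ofPred_forall]
  refine (isClosed_eq (by fun_prop) continuous_id).inter (isClosed_iInter fun x => ?_)
  exact isClosed_le continuous_const (by fun_prop)

omit [Fintype n] in
theorem PosSemidef.posDef_of_sub_smul_one [DecidableEq n] {X : Matrix n n ℝ} {q : ℝ} (hq : 0 < q)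
    (h : (X - q • (1 : Matrix n n ℝ)).PosSemidef) : X.PosDef := by
  have := (PosDef.one (n := n) (R := ℝ)).smul hq |>.add_posSemidef h
  simpa using this

end PosSemidef

end Matrix

/-- Cauchy–Schwarz. Apart from nonnegativity, this is the only property of the spectral norm that
the estimates use. -/
theorem spectralNorm2_smul_one_sub_posSemidef {n : ℕ} {X : Matrix (Fin n) (Fin n) ℝ}
    (hX : Xᵀ = X) : (spectralNorm2 X • (1 : Matrix (Fin n) (Fin n) ℝ) - X).PosSemidef := by
  refine Matrix.posSemidef_real_iff.2 ⟨by simp [hX], fun x => ?_⟩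
  rw [Matrix.sub_mulVec, dotProduct_sub, sub_nonneg, Matrix.smul_mulVec, Matrix.one_mulVec,
    dotProduct_smul]
  have h1 := real_inner_le_norm (WithLp.toLp 2 x)
    (Matrix.toEuclideanCLM (n := Fin n) (𝕜 := ℝ) X (WithLp.toLp 2 x))
  have h2 := (Matrix.toEuclideanCLM (n := Fin n) (𝕜 := ℝ) X).le_opNorm (WithLp.toLp 2 x)
  have h3 : x ⬝ᵥ x = ‖WithLp.toLp 2 x‖ ^ 2 := by
    rw [EuclideanSpace.norm_sq_eq]; simp [dotProduct, sq]
  rw [Matrix.inner_toEuclideanCLM] at h1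
  rw [h3, spectralNorm2, smul_eq_mul]
  have := mul_le_mul_of_nonneg_left h2 (norm_nonneg (WithLp.toLp 2 x))
  simp only at h1 this ⊢
  nlinarith

theorem spectralNorm2_nonneg {n : ℕ} (X : Matrix (Fin n) (Fin n) ℝ) : 0 ≤ spectralNorm2 X :=
  norm_nonneg _

/-- In a complex Banach algebra, the powers of an element whose spectrum lies in the open unit disc
tend to zero. -/
theorem tendsto_pow_atTop_nhds_zero_of_spectrum {𝔸 : Type*} [NormedRing 𝔸] [NormedAlgebra ℂ 𝔸]
    [CompleteSpace 𝔸] (a : 𝔸) (h : ∀ z ∈ spectrum ℂ a, ‖z‖ < 1) :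
    Tendsto (fun k : ℕ => a ^ k) atTop (𝓝 0) := by
  nontriviality 𝔸
  have h1 : spectralRadius ℂ a < ((1 : NNReal) : ℝ≥0∞) :=
    spectrum.spectralRadius_lt_of_forall_lt a fun z hz => by
      simpa [← NNReal.coe_lt_coe] using h z hz
  obtain ⟨r, hr, hr1⟩ := ENNReal.lt_iff_exists_nnreal_btwn.1 h1
  -- Gelfand's formula: eventually `‖a ^ k‖ ≤ r ^ k`, with `r` strictly between the spectral radius
  -- and `1`.
  have h2 := (spectrum.pow_nnnorm_pow_one_div_tendsto_nhds_spectralRadius a).eventually_lt_const hr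
  have hr1' : (r : ℝ) < 1 := by exact_mod_cast hr1
  refine squeeze_zero_norm' ?_ (tendsto_pow_atTop_nhds_zero_of_lt_one r.2 hr1')
  filter_upwards [h2, eventually_gt_atTop 0] with k hk hk0
  have hk1 : ((‖a ^ k‖₊ : ℝ≥0∞) ^ (1 / k : ℝ)) ^ (k : ℝ) ≤ (r : ℝ≥0∞) ^ (k : ℝ) :=
    ENNReal.rpow_le_rpow hk.le (by positivity)
  rw [← ENNReal.rpow_mul, one_div_mul_cancel (by positivity), ENNReal.rpow_one,
    ENNReal.rpow_natCast] at hk1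
  exact_mod_cast hk1

/-! ### Hurwitz matrices and the Lyapunov equation. -/

section Hurwitz

variable {n : ℕ} {F : Matrix (Fin n) (Fin n) ℝ}

theorem IsHurwitz.isUnit_smul_one_sub (hF : IsHurwitz F) {w : ℂ} (hw : 0 ≤ w.re) :
    IsUnit (w • (1 : Matrix (Fin n) (Fin n) ℂ) - F.map (algebraMap ℝ ℂ)) := by
  by_contra hcon
  have : w ∈ spectrum ℂ (F.map (algebraMap ℝ ℂ)) := by
    rw [spectrum.mem_iff, Algebra.algebraMap_eq_smul_one]; exact hcon
  exact absurd (hF w this) (not_lt.2 hw)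

theorem IsHurwitz.transpose (hF : IsHurwitz F) : IsHurwitz Fᵀ := by
  intro z hz
  refine hF z ?_
  rw [spectrum.mem_iff] at hz ⊢
  rwa [← Matrix.isUnit_transpose, Matrix.transpose_sub, Matrix.algebraMap_eq_diagonal,
    Matrix.diagonal_transpose, ← Matrix.algebraMap_eq_diagonal, ← Matrix.transpose_map]

theorem IsHurwitz.isUnit_one_sub (hF : IsHurwitz F) : IsUnit (1 - F) := by
  have h := hF.isUnit_smul_one_sub (w := 1) (by simp)
  rw [one_smul, Matrix.isUnit_iff_isUnit_det, isUnit_iff_ne_zero] at h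
  rw [Matrix.isUnit_iff_isUnit_det, isUnit_iff_ne_zero]
  intro h0
  apply h
  have : (1 : Matrix (Fin n) (Fin n) ℂ) - F.map (algebraMap ℝ ℂ)
      = (algebraMap ℝ ℂ).mapMatrix (1 - F) := by
    rw [map_sub, map_one]; rfl
  rw [this, ← RingHom.map_det, h0, map_zero]

/-- The powers of the Cayley transform of a Hurwitz matrix tend to zero. -/
theorem IsHurwitz.tendsto_cayley_pow (hF : IsHurwitz F) :
    Tendsto (fun k : ℕ => ((1 + F) * (1 - F)⁻¹) ^ k) atTop (𝓝 0) := by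
  set φ := (algebraMap ℝ ℂ).mapMatrix (m := Fin n) with hφ
  set S := (1 + F) * (1 - F)⁻¹ with hS
  have hu : IsUnit (1 - F).det := (Matrix.isUnit_iff_isUnit_det _).1 hF.isUnit_one_sub
  have hT : (1 - φ F) * φ (1 - F)⁻¹ = 1 := by
    rw [← map_one φ, ← map_sub, ← map_mul, Matrix.mul_nonsing_inv _ hu]
  have hT' : φ (1 - F)⁻¹ * (1 - φ F) = 1 := by
    rw [← map_one φ, ← map_sub, ← map_mul, Matrix.nonsing_inv_mul _ hu]
  have hTu : IsUnit (φ (1 - F)⁻¹) := ⟨⟨_, _, hT', hT⟩, rfl⟩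
  have hφS : φ S = (1 + φ F) * φ (1 - F)⁻¹ := by rw [hS, map_mul, map_add, map_one]
  have hspec : ∀ z ∈ spectrum ℂ (φ S), ‖z‖ < 1 := by
    intro z hz
    by_contra! hz1
    rw [spectrum.mem_iff, Algebra.algebraMap_eq_smul_one] at hz
    apply hz
    have key : z • (1 : Matrix (Fin n) (Fin n) ℂ) - φ S =
        (z • (1 - φ F) - (1 + φ F)) * φ (1 - F)⁻¹ := by
      rw [Matrix.sub_mul, hφS, Matrix.smul_mul, hT]
    rw [key]
    refine IsUnit.mul ?_ hTu
    -- The inverse Cayley map `(z - 1) / (z + 1)` has real part `(|z|² - 1) / |z + 1|²`, nonnegative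
    -- for `|z| ≥ 1`, hence is not an eigenvalue of `F`. The point `z = -1` corresponds to infinity.
    by_cases hz2 : z + 1 = 0
    · have : z • (1 - φ F) - (1 + φ F) = (-2 : ℂ) • (1 : Matrix (Fin n) (Fin n) ℂ) := by
        rw [eq_neg_of_add_eq_zero_left hz2]; module
      rw [this]
      exact (isUnit_one.smul (Units.mk0 (-2 : ℂ) (by norm_num)))
    · have : z • (1 - φ F) - (1 + φ F) = (z + 1) • (((z - 1) / (z + 1)) • 1 - φ F) := by
        rw [smul_sub (z + 1), smul_smul, mul_div_cancel₀ _ hz2]; module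
      rw [this]
      refine (hF.isUnit_smul_one_sub (w := (z - 1) / (z + 1)) ?_).smul (Units.mk0 (z + 1) hz2)
      have h1 : 1 ≤ Complex.normSq z := by
        rw [Complex.normSq_eq_norm_sq]; nlinarith
      rw [Complex.div_re, ← add_div]
      refine div_nonneg ?_ (Complex.normSq_nonneg _)
      rw [Complex.normSq_apply] at h1
      simp only [Complex.sub_re, Complex.one_re, Complex.add_re, Complex.sub_im, Complex.one_im,
        Complex.add_im]
      nlinarith
  have h := tendsto_pow_atTop_nhds_zero_of_spectrum (φ S) hspec
  refine tendsto_zero_iff_norm_tendsto_zero.2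
    ((tendsto_zero_iff_norm_tendsto_zero.1 h).congr fun k => ?_)
  rw [← map_pow]
  exact Matrix.frobenius_norm_map_eq _ _ fun a => by simp

/-- Converts the continuous-time Lyapunov operator of `F` into the discrete-time one of its Cayley
transform, so that powers tending to zero take over the role of the matrix exponential. -/
theorem cayley_conj_sub (hF : IsUnit (1 - F)) (X : Matrix (Fin n) (Fin n) ℝ) :
    ((1 + F) * (1 - F)⁻¹)ᵀ * X * ((1 + F) * (1 - F)⁻¹) - X =
      ((1 - F)⁻¹)ᵀ * ((2 : ℝ) • (Fᵀ * X + X * F)) * (1 - F)⁻¹ := by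
  have hu : IsUnit (1 - F).det := (Matrix.isUnit_iff_isUnit_det _).1 hF
  have hT : (1 - F) * (1 - F)⁻¹ = 1 := Matrix.mul_nonsing_inv _ hu
  have hT' : ((1 - F)⁻¹)ᵀ * (1 - F)ᵀ = 1 := by
    rw [← Matrix.transpose_mul, hT, Matrix.transpose_one]
  have h1 : (2 : ℝ) • (Fᵀ * X + X * F) =
      (1 + F)ᵀ * X * (1 + F) - (1 - F)ᵀ * X * (1 - F) := by
    rw [Matrix.transpose_add, Matrix.transpose_sub, Matrix.transpose_one, two_smul]
    noncomm_ring
  have h2 : X = ((1 - F)⁻¹)ᵀ * ((1 - F)ᵀ * X * (1 - F)) * (1 - F)⁻¹ := by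
    rw [Matrix.mul_assoc _ _ (1 - F)⁻¹, Matrix.mul_assoc _ (1 - F), hT, Matrix.mul_one,
      ← Matrix.mul_assoc, hT', Matrix.one_mul]
  rw [h1, Matrix.mul_sub, Matrix.sub_mul, ← h2, Matrix.transpose_mul]
  simp only [Matrix.mul_assoc]

theorem IsHurwitz.eq_zero_of_lyapunov (hF : IsHurwitz F) {X : Matrix (Fin n) (Fin n) ℝ}
    (h : Fᵀ * X + X * F = 0) : X = 0 := by
  have h1 := cayley_conj_sub hF.isUnit_one_sub X
  have hS0 := hF.tendsto_cayley_pow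
  set S := (1 + F) * (1 - F)⁻¹ with hS
  rw [h, smul_zero, Matrix.mul_zero, Matrix.zero_mul, sub_eq_zero] at h1
  have h2 : ∀ k : ℕ, (S ^ k)ᵀ * X * S ^ k = X := by
    intro k
    induction k with
    | zero => simp
    | succ k ih =>
      rw [pow_succ, Matrix.transpose_mul]
      calc Sᵀ * (S ^ k)ᵀ * X * (S ^ k * S) = Sᵀ * ((S ^ k)ᵀ * X * S ^ k) * S := by
            simp only [Matrix.mul_assoc]
        _ = X := by rw [ih, h1]
  have hlim : Tendsto (fun k : ℕ => (S ^ k)ᵀ * X * S ^ k) atTop (𝓝 (0ᵀ * X * 0)) :=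
    (((Continuous.matrix_transpose continuous_id).tendsto _).comp hS0 |>.mul_const X).mul hS0
  simp only [h2, Matrix.mul_zero] at hlim
  exact tendsto_nhds_unique tendsto_const_nhds hlim

/-- Comparison principle for the Lyapunov operator of a Hurwitz matrix. -/
theorem IsHurwitz.posSemidef_of_lyapunov (hF : IsHurwitz F) {X : Matrix (Fin n) (Fin n) ℝ}
    (h : (-(Fᵀ * X + X * F)).PosSemidef) : X.PosSemidef := by
  have h1 := cayley_conj_sub hF.isUnit_one_sub X
  have hS0 := hF.tendsto_cayley_pow
  set S := (1 + F) * (1 - F)⁻¹ with hS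
  have h1' : (X - Sᵀ * X * S).PosSemidef := by
    rw [← neg_sub, h1]
    have := (h.smul (zero_le_two (α := ℝ))).transpose_mul_mul_same (1 - F)⁻¹
    convert this using 1
    rw [smul_neg, Matrix.mul_neg, Matrix.neg_mul]
  -- Iterating `X ≥ Sᵀ X S` bounds `X` below by matrices that tend to zero.
  have h2 : ∀ k : ℕ, (X - (S ^ k)ᵀ * X * S ^ k).PosSemidef := by
    intro k
    induction k with
    | zero => simpa using Matrix.PosSemidef.zero
    | succ k ih =>
      convert (ih.transpose_mul_mul_same S).add h1' using 1
      rw [pow_succ, Matrix.transpose_mul, Matrix.mul_sub, Matrix.sub_mul]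
      simp only [Matrix.mul_assoc]
      abel
  have hlim : Tendsto (fun k : ℕ => X - (S ^ k)ᵀ * X * S ^ k) atTop (𝓝 (X - 0ᵀ * X * 0)) :=
    ((((Continuous.matrix_transpose continuous_id).tendsto _).comp hS0
      |>.mul_const X).mul hS0).const_sub X
  have := Matrix.isClosed_setOf_posSemidef.mem_of_tendsto hlim (Eventually.of_forall h2)
  simpa using this

/-- Lyapunov's criterion. -/
theorem isHurwitz_of_lyapunov {P : Matrix (Fin n) (Fin n) ℝ} (hP : P.PosDef)
    (h : (-(Fᵀ * P + P * F)).PosDef) : IsHurwitz F := by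
  intro z hz
  rw [spectrum.mem_iff, Algebra.algebraMap_eq_smul_one, Matrix.isUnit_iff_isUnit_det,
    isUnit_iff_ne_zero, not_not] at hz
  obtain ⟨v, hv, hv0⟩ := Matrix.exists_mulVec_eq_zero_iff.2 hz
  rw [Matrix.sub_mulVec, sub_eq_zero, Matrix.smul_mulVec, Matrix.one_mulVec] at hv0
  -- For the eigenvector `v = a + i b`, the sum of the real quadratic forms at `a` and `b` is the
  -- Hermitian form at `v`; it equals `-2 Re z` times the form of `P`, which fixes the sign of `Re
  -- z`.
  set a : Fin n → ℝ := fun i => (v i).re with ha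
  set b : Fin n → ℝ := fun i => (v i).im with hb
  have hFa : F *ᵥ a = z.re • a - z.im • b := by
    ext i
    have := congrArg Complex.re (congrFun hv0 i)
    simp only [Matrix.mulVec, dotProduct, Pi.smul_apply, smul_eq_mul, Complex.mul_re,
      Complex.re_sum, Matrix.map_apply, Complex.coe_algebraMap, Complex.ofReal_re,
      Complex.ofReal_im, zero_mul, sub_zero] at this
    simp [Matrix.mulVec, dotProduct, ha, hb, this]
  have hFb : F *ᵥ b = z.im • a + z.re • b := by
    ext i
    have := congrArg Complex.im (congrFun hv0 i)
    simp only [Matrix.mulVec, dotProduct, Pi.smul_apply, smul_eq_mul, Complex.mul_im,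
      Complex.im_sum, Matrix.map_apply, Complex.coe_algebraMap, Complex.ofReal_re,
      Complex.ofReal_im, zero_mul, add_zero] at this
    simp only [Matrix.mulVec, dotProduct, ha, hb, ← this, Pi.add_apply, Pi.smul_apply, smul_eq_mul]
    ring
  have hquad : ∀ x, x ⬝ᵥ ((-(Fᵀ * P + P * F)) *ᵥ x) = -2 * (x ⬝ᵥ (P *ᵥ (F *ᵥ x))) := by
    intro x
    have : x ⬝ᵥ ((Fᵀ * P) *ᵥ x) = x ⬝ᵥ (P *ᵥ (F *ᵥ x)) := by
      rw [← Matrix.mulVec_mulVec, Matrix.dotProduct_mulVec, Matrix.vecMul_transpose,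
        Matrix.dotProduct_mulVec, ← Matrix.mulVec_transpose, hP.transpose_eq, dotProduct_comm,
        Matrix.dotProduct_mulVec, ← Matrix.mulVec_transpose, hP.transpose_eq, dotProduct_comm]
    rw [Matrix.neg_mulVec, dotProduct_neg, Matrix.add_mulVec, dotProduct_add, this,
      ← Matrix.mulVec_mulVec]
    ring
  have hsymm : b ⬝ᵥ (P *ᵥ a) = a ⬝ᵥ (P *ᵥ b) := by
    rw [Matrix.dotProduct_mulVec, ← Matrix.mulVec_transpose, hP.transpose_eq, dotProduct_comm]
  have hsum : a ⬝ᵥ ((-(Fᵀ * P + P * F)) *ᵥ a) + b ⬝ᵥ ((-(Fᵀ * P + P * F)) *ᵥ b) =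
      -2 * z.re * (a ⬝ᵥ (P *ᵥ a) + b ⬝ᵥ (P *ᵥ b)) := by
    rw [hquad, hquad, hFa, hFb]
    simp only [Matrix.mulVec_sub, Matrix.mulVec_add, Matrix.mulVec_smul, dotProduct_sub,
      dotProduct_add, dotProduct_smul, smul_eq_mul, hsymm]
    ring
  have hN := (Matrix.posDef_real_iff.1 h).2
  have hN' := (Matrix.posSemidef_real_iff.1 h.posSemidef).2
  have hPP := (Matrix.posSemidef_real_iff.1 hP.posSemidef).2
  have hab : a ≠ 0 ∨ b ≠ 0 := by
    by_contra! hcon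
    apply hv
    ext i
    exact Complex.ext (congrFun hcon.1 i) (congrFun hcon.2 i)
  by_contra! hz0
  have h3 : 0 < a ⬝ᵥ ((-(Fᵀ * P + P * F)) *ᵥ a) + b ⬝ᵥ ((-(Fᵀ * P + P * F)) *ᵥ b) := by
    rcases hab with h0 | h0
    · exact add_pos_of_pos_of_nonneg (hN _ h0) (hN' _)
    · exact add_pos_of_nonneg_of_pos (hN' _) (hN _ h0)
  have := mul_nonneg hz0 (add_nonneg (hPP a) (hPP b))
  linarith

/-- A vector in the kernel of `X` annihilates the quadratic form of `Fᵀ X + X F`, which is negative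
definite. -/
theorem posDef_of_lyapunov {X : Matrix (Fin n) (Fin n) ℝ} (hX : X.PosSemidef)
    (h : (-(Fᵀ * X + X * F)).PosDef) : X.PosDef := by
  refine Matrix.posDef_real_iff.2 ⟨hX.transpose_eq, fun x hx => ?_⟩
  refine lt_of_le_of_ne ((Matrix.posSemidef_real_iff.1 hX).2 x) fun h0 => ?_
  have hx0 : X *ᵥ x = 0 := (hX.dotProduct_mulVec_zero_iff x).1 (by simpa using h0.symm)
  have h1 := (Matrix.posDef_real_iff.1 h).2 x hx
  have h3 : x ᵥ* X = 0 := by rw [← Matrix.mulVec_transpose, hX.transpose_eq, hx0]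
  rw [Matrix.neg_mulVec, dotProduct_neg, Matrix.add_mulVec, dotProduct_add,
    ← Matrix.mulVec_mulVec, hx0, ← Matrix.mulVec_mulVec, Matrix.dotProduct_mulVec x X, h3] at h1
  simp at h1

/-- The Lyapunov operator `X ↦ Fᵀ X + X F`. -/
def lyapunovMap (F : Matrix (Fin n) (Fin n) ℝ) :
    Matrix (Fin n) (Fin n) ℝ →ₗ[ℝ] Matrix (Fin n) (Fin n) ℝ :=
  LinearMap.mulLeft ℝ Fᵀ + LinearMap.mulRight ℝ F

theorem lyapunovMap_apply (F X : Matrix (Fin n) (Fin n) ℝ) :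
    lyapunovMap F X = Fᵀ * X + X * F := rfl

theorem IsHurwitz.lyapunovMap_injective (hF : IsHurwitz F) :
    Function.Injective (lyapunovMap F) :=
  (injective_iff_map_eq_zero (lyapunovMap F)).2 fun _ h => hF.eq_zero_of_lyapunov h

/-- In finite dimension injectivity of the Lyapunov operator gives existence; the comparison
principle then gives the sign. -/
theorem IsHurwitz.exists_lyapunov (hF : IsHurwitz F) {M : Matrix (Fin n) (Fin n) ℝ}
    (hM : M.PosDef) : ∃ X : Matrix (Fin n) (Fin n) ℝ, X.PosDef ∧ Fᵀ * X + X * F + M = 0 := by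
  obtain ⟨X, hX⟩ := LinearMap.injective_iff_surjective.1 hF.lyapunovMap_injective (-M)
  replace hX : Fᵀ * X + X * F = -M := hX
  have hpsd : X.PosSemidef := hF.posSemidef_of_lyapunov (by rw [hX, neg_neg]; exact hM.posSemidef)
  refine ⟨X, posDef_of_lyapunov hpsd (by rwa [hX, neg_neg]), by rw [hX]; simp⟩

theorem IsHurwitz.lyapunovSolution_spec (hF : IsHurwitz F) {M : Matrix (Fin n) (Fin n) ℝ}
    (hM : M.PosDef) : (lyapunovSolution F M).PosDef ∧
      Fᵀ * lyapunovSolution F M + lyapunovSolution F M * F + M = 0 := by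
  have h := hF.exists_lyapunov hM
  rw [lyapunovSolution, dif_pos h]
  exact h.choose_spec

theorem IsHurwitz.eq_lyapunovSolution (hF : IsHurwitz F) {M X : Matrix (Fin n) (Fin n) ℝ}
    (hM : M.PosDef) (hX : Fᵀ * X + X * F + M = 0) : X = lyapunovSolution F M := by
  refine hF.lyapunovMap_injective ?_
  rw [lyapunovMap_apply, lyapunovMap_apply, eq_neg_of_add_eq_zero_left hX,
    eq_neg_of_add_eq_zero_left (hF.lyapunovSolution_spec hM).2]

end Hurwitz

/-! ### Perturbation of positive definite matrices and of linear equations. -/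

namespace Matrix

variable {n m : Type*} [Fintype n] [Fintype m]

theorem trace_transpose_mul_le (X Y : Matrix m n ℝ) : (Xᵀ * Y).trace ≤ ‖X‖ * ‖Y‖ := by
  refine abs_le_of_sq_le_sq' ?_ (by positivity) |>.2
  rw [mul_pow, frobenius_norm_sq_eq_trace, frobenius_norm_sq_eq_trace]
  simp only [trace, diag_apply, mul_apply, transpose_apply, ← Finset.sum_product']
  simpa [sq] using Finset.sum_mul_sq_le_sq_mul_sq (Finset.univ ×ˢ Finset.univ : Finset (n × m))
    (fun p => X p.2 p.1) (fun p => Y p.2 p.1)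

/-- `2 s (s + X) = (s + X)² + (‖X‖² - X²) + (s² - ‖X‖²)` is a sum of positive semidefinite matrices.
-/
theorem smul_one_add_posSemidef_of_norm_le [DecidableEq n] {X : Matrix n n ℝ} (hX : Xᵀ = X)
    {s : ℝ} (hs : 0 < s) (h : ‖X‖ ≤ s) : (s • (1 : Matrix n n ℝ) + X).PosSemidef := by
  have h1 := posSemidef_transpose_mul_self (s • (1 : Matrix n n ℝ) + X)
  have h2 := norm_sq_smul_one_sub_posSemidef X
  have h3 : ((s ^ 2 - ‖X‖ ^ 2) • (1 : Matrix n n ℝ)).PosSemidef :=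
    PosSemidef.one.smul (sub_nonneg.2 (by gcongr))
  convert ((h1.add h2).add h3).smul (inv_nonneg.2 (mul_nonneg zero_le_two hs.le)) using 1
  rw [transpose_add, transpose_smul, transpose_one, hX]
  simp only [Matrix.add_mul, Matrix.mul_add, Matrix.smul_mul, Matrix.mul_smul, Matrix.one_mul,
    Matrix.mul_one]
  match_scalars <;> field_simp <;> ring

theorem PosDef.exists_forall_norm_sub_le_posDef [DecidableEq n] {X : Matrix n n ℝ}
    (hX : X.PosDef) : ∃ s > 0, ∀ X' : Matrix n n ℝ, X'ᵀ = X' → ‖X' - X‖ ≤ s → X'.PosDef := by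
  obtain ⟨q, hq, hqX⟩ := hX.exists_sub_smul_one_posSemidef
  refine ⟨q / 2, by positivity, fun X' hX' hn => ?_⟩
  refine PosSemidef.posDef_of_sub_smul_one (q := q / 2) (by positivity) ?_
  convert hqX.add (smul_one_add_posSemidef_of_norm_le (X := X' - X)
    (by rw [transpose_sub, hX', hX.transpose_eq]) (half_pos hq) hn) using 1
  module

end Matrix

/-- The solution of a linear equation with an injective operator depends continuously on the
operator and on the right-hand side. -/
theorem continuousOn_of_injective_linearMap {T E : Type*} [TopologicalSpace T]
    [NormedAddCommGroup E] [NormedSpace ℝ E] [FiniteDimensional ℝ E] {S : Set T}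
    (L : T → E →ₗ[ℝ] E) (hL : ∀ v, Continuous fun t => L t v)
    (hinj : ∀ t ∈ S, Function.Injective (L t)) {g p : T → E} (hg : ContinuousOn g S)
    (h : ∀ t ∈ S, L t (p t) = g t) : ContinuousOn p S := by
  have := FiniteDimensional.complete ℝ E
  set M : T → E →L[ℝ] E := fun t => (L t).toContinuousLinearMap with hM
  have hMc : Continuous M := continuous_clm_apply.2 hL
  have hu : ∀ t ∈ S, IsUnit (M t) := fun t ht =>
    ContinuousLinearMap.isUnit_iff_bijective.2
      ⟨hinj t ht, LinearMap.injective_iff_surjective.1 (hinj t ht)⟩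
  have h1 : ContinuousOn (fun t => Ring.inverse (M t) (g t)) S := by
    intro t ht
    obtain ⟨u, hu⟩ := hu t ht
    have h2 := NormedRing.inverse_continuousAt u
    rw [hu] at h2
    exact (h2.comp hMc.continuousAt).continuousWithinAt.clm_apply (hg t ht)
  refine h1.congr fun t ht => ?_
  have h2 := DFunLike.congr_fun (Ring.inverse_mul_cancel _ (hu t ht)) (p t)
  change p t = Ring.inverse (M t) (g t)
  rw [← h t ht]
  exact h2.symm

/-! ### The cost: compact sublevel sets, open domain, continuity. -/

section Regulator

variable {n m : ℕ} {A : Matrix (Fin n) (Fin n) ℝ} {B : Matrix (Fin n) (Fin m) ℝ}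
  {Q : Matrix (Fin n) (Fin n) ℝ} {R : Matrix (Fin m) (Fin m) ℝ} {K K' : Matrix (Fin m) (Fin n) ℝ}

theorem posDef_add_transpose_mul_mul (hQ : Q.PosDef) (hR : R.PosDef)
    (K : Matrix (Fin m) (Fin n) ℝ) : (Q + Kᵀ * R * K).PosDef :=
  hQ.add_posSemidef (hR.posSemidef.transpose_mul_mul_same K)

theorem costMatrix_posDef (hQ : Q.PosDef) (hR : R.PosDef) (hK : K ∈ stabilizingGains A B) :
    (costMatrix A B Q R K).PosDef :=
  (IsHurwitz.lyapunovSolution_spec hK (posDef_add_transpose_mul_mul hQ hR K)).1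

theorem costMatrix_eq (hQ : Q.PosDef) (hR : R.PosDef) (hK : K ∈ stabilizingGains A B) :
    (A - B * K)ᵀ * costMatrix A B Q R K + costMatrix A B Q R K * (A - B * K) +
      (Q + Kᵀ * R * K) = 0 :=
  (IsHurwitz.lyapunovSolution_spec hK (posDef_add_transpose_mul_mul hQ hR K)).2

theorem eq_costMatrix (hQ : Q.PosDef) (hR : R.PosDef) (hK : K ∈ stabilizingGains A B)
    {P : Matrix (Fin n) (Fin n) ℝ}
    (hP : (A - B * K)ᵀ * P + P * (A - B * K) + (Q + Kᵀ * R * K) = 0) :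
    P = costMatrix A B Q R K :=
  IsHurwitz.eq_lyapunovSolution hK (posDef_add_transpose_mul_mul hQ hR K) hP

/-- Taking traces bounds `r ‖K‖²` by an expression affine in `‖K‖`; the summand `1` covers the case
`‖K‖ ≤ 1`. -/
theorem norm_le_of_lyapunov (hQ : Q.PosDef) {r c : ℝ} (hr : 0 < r)
    (hrR : (R - r • (1 : Matrix (Fin m) (Fin m) ℝ)).PosSemidef)
    {P : Matrix (Fin n) (Fin n) ℝ} (hP : P.PosSemidef) (hc : P.trace ≤ c)
    (h : (A - B * K)ᵀ * P + P * (A - B * K) + (Q + Kᵀ * R * K) = 0) :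
    ‖K‖ ≤ 1 + 2 * c * (‖A‖ + ‖B‖) / r := by
  have hc0 : 0 ≤ c := hP.trace_nonneg.trans hc
  have h1 : r * ‖K‖ ^ 2 ≤ (Kᵀ * R * K).trace := by
    have := (hrR.transpose_mul_mul_same K).trace_nonneg
    rw [Matrix.mul_sub, Matrix.sub_mul, Matrix.trace_sub] at this
    rw [Matrix.frobenius_norm_sq_eq_trace]
    simp only [Matrix.mul_smul, Matrix.smul_mul, Matrix.mul_one, Matrix.trace_smul,
      smul_eq_mul] at this
    linarith
  have h2 : (P * (A - B * K)).trace = ((A - B * K)ᵀ * P).trace := by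
    rw [← Matrix.trace_transpose, Matrix.transpose_mul, hP.transpose_eq]
  have h3 := congrArg Matrix.trace h
  rw [Matrix.trace_add, Matrix.trace_add, Matrix.trace_add, Matrix.trace_zero, h2] at h3
  have h4 := Matrix.trace_transpose_mul_le (-(A - B * K)) P
  rw [Matrix.transpose_neg, Matrix.neg_mul, Matrix.trace_neg, norm_neg] at h4
  have h5 : ‖A - B * K‖ ≤ ‖A‖ + ‖B‖ * ‖K‖ :=
    (norm_sub_le _ _).trans (by gcongr; exact Matrix.frobenius_norm_mul _ _)
  have h6 : ‖A - B * K‖ * ‖P‖ ≤ (‖A‖ + ‖B‖ * ‖K‖) * c := by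
    gcongr
    exact hP.norm_le_trace.trans hc
  have h7 := hQ.posSemidef.trace_nonneg
  have h8 : r * ‖K‖ ^ 2 ≤ 2 * c * (‖A‖ + ‖B‖ * ‖K‖) := by linarith
  rcases le_or_gt ‖K‖ 1 with hK | hK
  · have : 0 ≤ 2 * c * (‖A‖ + ‖B‖) / r := by positivity
    linarith
  · have h9 : 2 * c * (‖A‖ + ‖B‖ * ‖K‖) ≤ 2 * c * ((‖A‖ + ‖B‖) * ‖K‖) := by
      gcongr
      nlinarith [norm_nonneg A]
    have h10 : ‖K‖ * r ≤ 2 * c * (‖A‖ + ‖B‖) := by nlinarith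
    have := (le_div_iff₀ hr).2 h10
    linarith

/-- The set is the projection of a closed bounded set of pairs `(K, P)`. Stability survives in the
limit because a positive semidefinite solution of the Lyapunov equation already forces `P` to be
definite and `A - B K` to be Hurwitz. -/
theorem isCompact_setOf_lqrCost_le (hQ : Q.PosDef) (hR : R.PosDef) (c : ℝ) :
    IsCompact {K | K ∈ stabilizingGains A B ∧ lqrCost A B Q R K ≤ c} := by
  obtain ⟨r, hr, hrR⟩ := hR.exists_sub_smul_one_posSemidef
  set Z : Set (Matrix (Fin m) (Fin n) ℝ × Matrix (Fin n) (Fin n) ℝ) :=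
    {p | p.2.PosSemidef ∧ p.2.trace ≤ c ∧
      (A - B * p.1)ᵀ * p.2 + p.2 * (A - B * p.1) + (Q + p.1ᵀ * R * p.1) = 0} with hZ
  have hclosed : IsClosed Z := by
    rw [hZ, Set.ofPred_and, Set.ofPred_and]
    refine (Matrix.isClosed_setOf_posSemidef.preimage continuous_snd).inter
      ((isClosed_le ?_ continuous_const).inter (isClosed_eq ?_ continuous_const))
    · exact continuous_snd.matrix_trace
    · fun_prop
  have hbdd : Bornology.IsBounded Z := by
    refine (Metric.isBounded_closedBall (x := 0) (r := 1 + 2 * c * (‖A‖ + ‖B‖) / r)).prod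
      (Metric.isBounded_closedBall (x := 0) (r := c)) |>.subset fun p hp => ?_
    simp only [Set.mem_prod, mem_closedBall_zero_iff]
    exact ⟨norm_le_of_lyapunov hQ hr hrR hp.1 hp.2.1 hp.2.2, hp.1.norm_le_trace.trans hp.2.1⟩
  have : {K | K ∈ stabilizingGains A B ∧ lqrCost A B Q R K ≤ c} = Prod.fst '' Z := by
    ext K
    constructor
    · rintro ⟨hK, hKc⟩
      exact ⟨(K, costMatrix A B Q R K),
        ⟨(costMatrix_posDef hQ hR hK).posSemidef, hKc, costMatrix_eq hQ hR hK⟩, rfl⟩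
    · rintro ⟨⟨K, P⟩, ⟨h1, h2, h3⟩, rfl⟩
      simp only at h1 h2 h3 ⊢
      have hM : (-((A - B * K)ᵀ * P + P * (A - B * K))).PosDef := by
        rw [eq_neg_of_add_eq_zero_left h3, neg_neg]
        exact posDef_add_transpose_mul_mul hQ hR K
      have hK : K ∈ stabilizingGains A B := isHurwitz_of_lyapunov (posDef_of_lyapunov h1 hM) hM
      refine ⟨hK, ?_⟩
      rwa [lqrCost, ← eq_costMatrix hQ hR hK h3]
  rw [this]
  exact (Metric.isCompact_of_isClosed_isBounded hclosed hbdd).image continuous_fst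

/-- A Lyapunov matrix of one gain still serves for all nearby gains; the weights `1` are an
arbitrary choice. -/
theorem isOpen_stabilizingGains : IsOpen (stabilizingGains A B) := by
  refine Metric.isOpen_iff.2 fun K hK => ?_
  have hQ : (1 : Matrix (Fin n) (Fin n) ℝ).PosDef := Matrix.PosDef.one
  have hR : (1 : Matrix (Fin m) (Fin m) ℝ).PosDef := Matrix.PosDef.one
  have hP := costMatrix_posDef hQ hR hK
  have hE := costMatrix_eq hQ hR hK
  set P := costMatrix A B 1 1 K
  have hM : (-((A - B * K)ᵀ * P + P * (A - B * K))).PosDef := by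
    rw [eq_neg_of_add_eq_zero_left hE, neg_neg]
    exact posDef_add_transpose_mul_mul hQ hR K
  obtain ⟨s, hs, hs'⟩ := hM.exists_forall_norm_sub_le_posDef
  have hcont : Continuous fun L : Matrix (Fin m) (Fin n) ℝ =>
      -((A - B * L)ᵀ * P + P * (A - B * L)) := by fun_prop
  obtain ⟨δ, hδ, h⟩ := Metric.continuous_iff.1 hcont K s hs
  refine ⟨δ, hδ, fun L hL => isHurwitz_of_lyapunov hP (hs' _ ?_ ?_)⟩
  · simp only [Matrix.transpose_neg, Matrix.transpose_add, Matrix.transpose_mul,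
      Matrix.transpose_transpose, hP.transpose_eq]
    rw [add_comm]
  · rw [← dist_eq_norm]
    exact (h L hL).le

theorem continuousOn_costMatrix (hQ : Q.PosDef) (hR : R.PosDef) :
    ContinuousOn (costMatrix A B Q R) (stabilizingGains A B) := by
  refine continuousOn_of_injective_linearMap (fun K => lyapunovMap (A - B * K))
    (fun X => ?_) (fun K hK => IsHurwitz.lyapunovMap_injective hK)
    (g := fun K => -(Q + Kᵀ * R * K)) ?_ fun K hK => ?_
  · simp only [lyapunovMap_apply]
    fun_prop
  · exact Continuous.continuousOn (by fun_prop)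
  · rw [lyapunovMap_apply, eq_neg_of_add_eq_zero_left (costMatrix_eq hQ hR hK)]

theorem continuousOn_lqrCost (hQ : Q.PosDef) (hR : R.PosDef) :
    ContinuousOn (lqrCost A B Q R) (stabilizingGains A B) :=
  continuous_id.matrix_trace.comp_continuousOn (continuousOn_costMatrix hQ hR)

theorem lqrCost_nonneg (hQ : Q.PosDef) (hR : R.PosDef) (hK : K ∈ stabilizingGains A B) :
    0 ≤ lqrCost A B Q R K := (costMatrix_posDef hQ hR hK).posSemidef.trace_nonneg

end Regulator

/-! ### The effect of one step on the cost matrix, and the Riccati equation. -/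

section Regulator

variable {n m : ℕ} {A : Matrix (Fin n) (Fin n) ℝ} {B : Matrix (Fin n) (Fin m) ℝ}
  {Q : Matrix (Fin n) (Fin n) ℝ} {R : Matrix (Fin m) (Fin m) ℝ} {K K' : Matrix (Fin m) (Fin n) ℝ}

/-- The Lyapunov equation of one gain rewritten with the closed loop of another gain. -/
theorem lyapunov_change_gain {P : Matrix (Fin n) (Fin n) ℝ} (hP : Pᵀ = P) (hR : Rᵀ = R)
    (h : (A - B * K)ᵀ * P + P * (A - B * K) + (Q + Kᵀ * R * K) = 0)
    (E : Matrix (Fin m) (Fin n) ℝ) :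
    (A - B * (K + E))ᵀ * P + P * (A - B * (K + E)) + (Q + (K + E)ᵀ * R * (K + E)) =
      Eᵀ * (R * K - Bᵀ * P) + (R * K - Bᵀ * P)ᵀ * E + Eᵀ * R * E := by
  rw [← sub_zero ((A - B * (K + E))ᵀ * P + P * (A - B * (K + E)) +
    (Q + (K + E)ᵀ * R * (K + E))), ← h]
  simp only [Matrix.transpose_sub, Matrix.transpose_mul, Matrix.transpose_add, hP, hR,
    Matrix.transpose_transpose, Matrix.mul_add, Matrix.add_mul, Matrix.mul_sub, Matrix.sub_mul,
    Matrix.mul_assoc]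
  abel

/-- Completes the square in `2 M + W` for the increment `E = -t (2 M + W)` of
`lyapunov_change_gain`. When `t R ≤ 1/2` only the `Wᵀ W` term has an unfavourable sign. -/
theorem neg_forcing_eq (R : Matrix (Fin m) (Fin m) ℝ) (M W : Matrix (Fin m) (Fin n) ℝ) (t : ℝ) :
    -((-(t • ((2 : ℝ) • M + W)))ᵀ * M + Mᵀ * (-(t • ((2 : ℝ) • M + W))) +
        (-(t • ((2 : ℝ) • M + W)))ᵀ * R * (-(t • ((2 : ℝ) • M + W)))) =
      (2 * t) • (Mᵀ * M) - (t / 2) • (Wᵀ * W) +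
        t • (((2 : ℝ) • M + W)ᵀ * ((1 / 2 : ℝ) • (1 : Matrix (Fin m) (Fin m) ℝ) - t • R) *
          ((2 : ℝ) • M + W)) := by
  simp only [Matrix.transpose_neg, Matrix.transpose_add, Matrix.transpose_smul, Matrix.mul_add,
    Matrix.add_mul, Matrix.mul_sub, Matrix.sub_mul, Matrix.mul_smul, Matrix.smul_mul,
    Matrix.mul_one, Matrix.neg_mul, Matrix.mul_neg, smul_add, smul_sub]
  module

/-- Effect on the cost matrix of one perturbed natural gradient step with a small step size. -/
theorem naturalStep_costMatrix (hQ : Q.PosDef) (hR : R.PosDef) (hK : K ∈ stabilizingGains A B)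
    {t q : ℝ} (ht : 0 ≤ t)
    (htR : ((1 / 2 : ℝ) • (1 : Matrix (Fin m) (Fin m) ℝ) - t • R).PosSemidef) (hq : 0 < q)
    (hqQ : (Q - q • (1 : Matrix (Fin n) (Fin n) ℝ)).PosSemidef) (W : Matrix (Fin m) (Fin n) ℝ)
    (hW : t * ‖W‖ ^ 2 ≤ q) :
    K - t • ((2 : ℝ) • (R * K - Bᵀ * costMatrix A B Q R K) + W) ∈ stabilizingGains A B ∧
    ((1 + t * ‖W‖ ^ 2 / q) • costMatrix A B Q R K - costMatrix A B Q R
      (K - t • ((2 : ℝ) • (R * K - Bᵀ * costMatrix A B Q R K) + W))).PosSemidef := by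
  have hP := costMatrix_posDef hQ hR hK
  have hE := lyapunov_change_gain hP.transpose_eq hR.transpose_eq (costMatrix_eq hQ hR hK)
    (-(t • ((2 : ℝ) • (R * K - Bᵀ * costMatrix A B Q R K) + W)))
  rw [← sub_eq_add_neg] at hE
  set P := costMatrix A B Q R K
  set M := R * K - Bᵀ * P
  set L := K - t • ((2 : ℝ) • M + W)
  have hX : ((t / 2 * ‖W‖ ^ 2) • (1 : Matrix (Fin n) (Fin n) ℝ) -
      ((A - B * L)ᵀ * P + P * (A - B * L) + (Q + Lᵀ * R * L))).PosSemidef := by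
    rw [hE, sub_eq_add_neg, neg_forcing_eq]
    convert (((Matrix.posSemidef_transpose_mul_self M).smul (mul_nonneg zero_le_two ht)).add
      ((Matrix.norm_sq_smul_one_sub_posSemidef W).smul
        (div_nonneg ht zero_le_two))).add
      ((htR.transpose_mul_mul_same ((2 : ℝ) • M + W)).smul ht) using 1
    module
  set S := (A - B * L)ᵀ * P + P * (A - B * L) with hS
  have hLR := hR.posSemidef.transpose_mul_mul_same L
  have hdef : (-S).PosDef := by
    refine Matrix.PosSemidef.posDef_of_sub_smul_one (half_pos hq) ?_
    have h1 : ((q / 2 - t / 2 * ‖W‖ ^ 2) • (1 : Matrix (Fin n) (Fin n) ℝ)).PosSemidef :=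
      Matrix.PosSemidef.one.smul (by linarith)
    convert ((h1.add hqQ).add hLR).add hX using 1
    module
  have hL : L ∈ stabilizingGains A B := isHurwitz_of_lyapunov hP hdef
  refine ⟨hL, IsHurwitz.posSemidef_of_lyapunov hL ?_⟩
  have hE' := costMatrix_eq hQ hR hL
  set P' := costMatrix A B Q R L
  set w := t * ‖W‖ ^ 2 with hw
  have hw0 : 0 ≤ w := by positivity
  have hs0 : 0 ≤ w / q := by positivity
  have hs1 : w / q ≤ 1 := (div_le_one hq).2 hW
  have hsq : w / q * q = w := div_mul_cancel₀ _ hq.ne'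
  -- Scaling `P` by `1 + w / q` gains `(w / q) Q ≥ w`, which pays for the scaled residual `(1 + w /
  -- q) w / 2 ≤ w`, as `w ≤ q`.
  have h1 : ((w / q * q - (1 + w / q) * (w / 2)) •
      (1 : Matrix (Fin n) (Fin n) ℝ)).PosSemidef :=
    Matrix.PosSemidef.one.smul (by rw [hsq]; nlinarith)
  convert ((h1.add (hqQ.smul hs0)).add (hLR.smul hs0)).add
    (hX.smul (add_nonneg zero_le_one hs0)) using 1
  have h2 : (A - B * L)ᵀ * ((1 + w / q) • P - P') + ((1 + w / q) • P - P') * (A - B * L) =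
      (1 + w / q) • S + (Q + Lᵀ * R * L) := by
    have : (A - B * L)ᵀ * P' + P' * (A - B * L) = -(Q + Lᵀ * R * L) :=
      eq_neg_of_add_eq_zero_left hE'
    rw [Matrix.mul_sub, Matrix.sub_mul, Matrix.mul_smul, Matrix.smul_mul, hS, smul_add]
    rw [← neg_neg (Q + Lᵀ * R * L), ← this]
    abel
  rw [h2, show t / 2 * ‖W‖ ^ 2 = w / 2 by rw [hw]; ring]
  module

theorem half_smul_one_sub_smul_posSemidef (hR : R.PosDef) {t : ℝ} (ht : 0 ≤ t)
    (h : t * spectralNorm2 R ≤ 1 / 2) :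
    ((1 / 2 : ℝ) • (1 : Matrix (Fin m) (Fin m) ℝ) - t • R).PosSemidef := by
  have h1 : ((1 / 2 - t * spectralNorm2 R) • (1 : Matrix (Fin m) (Fin m) ℝ)).PosSemidef :=
    Matrix.PosSemidef.one.smul (by linarith)
  convert h1.add ((spectralNorm2_smul_one_sub_posSemidef hR.transpose_eq).smul ht) using 1
  module

/-- At a minimiser of the cost, the natural gradient vanishes. -/
theorem naturalGradient_eq_zero_of_isMinOn (hQ : Q.PosDef) (hR : R.PosDef)
    (hK : K ∈ stabilizingGains A B)
    (hmin : ∀ L ∈ stabilizingGains A B, lqrCost A B Q R K ≤ lqrCost A B Q R L) :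
    R * K - Bᵀ * costMatrix A B Q R K = 0 := by
  obtain ⟨q, hq, hqQ⟩ := hQ.exists_sub_smul_one_posSemidef
  have hs := spectralNorm2_nonneg R
  set t : ℝ := 1 / (2 * (spectralNorm2 R + 1)) with ht
  have ht0 : 0 < t := by positivity
  have htR := half_smul_one_sub_smul_posSemidef hR ht0.le (by
    rw [ht, one_div_mul_eq_div, div_le_div_iff₀ (by positivity) two_pos]; linarith)
  obtain ⟨hL, hle⟩ := naturalStep_costMatrix hQ hR hK ht0.le htR hq hqQ 0 (by simpa using hq.le)
  have hE := lyapunov_change_gain (costMatrix_posDef hQ hR hK).transpose_eq hR.transpose_eq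
    (costMatrix_eq hQ hR hK) (-(t • ((2 : ℝ) • (R * K - Bᵀ * costMatrix A B Q R K) + 0)))
  rw [← sub_eq_add_neg] at hE
  have hmin' := hmin _ hL
  have hE' := costMatrix_eq hQ hR hL
  set P := costMatrix A B Q R K
  set M := R * K - Bᵀ * P
  set L := K - t • ((2 : ℝ) • M + 0)
  -- An unperturbed step gives `P_L ≤ P`, and minimality of the trace forces equality. The residual
  -- of `P` at `L` then vanishes, and with it its part `2 t Mᵀ M`.
  have hPP : P = costMatrix A B Q R L := by
    rw [norm_zero] at hle
    simp only [ne_eq, OfNat.ofNat_ne_zero, not_false_eq_true, zero_pow, mul_zero, zero_div,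
      add_zero, one_smul] at hle
    refine sub_eq_zero.1 (hle.trace_eq_zero_iff.1 (le_antisymm ?_ hle.trace_nonneg))
    rw [Matrix.trace_sub]
    exact sub_nonpos.2 hmin'
  rw [← hPP] at hE'
  rw [hE', ← neg_eq_zero.trans eq_comm, neg_forcing_eq] at hE
  have h1 := congrArg Matrix.trace hE
  have h2 := ((htR.transpose_mul_mul_same ((2 : ℝ) • M + 0)).smul ht0.le).trace_nonneg
  rw [Matrix.trace_add, Matrix.mul_zero, smul_zero, sub_zero, Matrix.trace_smul,
    ← Matrix.frobenius_norm_sq_eq_trace, Matrix.trace_zero, smul_eq_mul] at h1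
  have h3 : 0 ≤ 2 * t * ‖M‖ ^ 2 := by positivity
  have h4 : 2 * t * ‖M‖ ^ 2 = 0 := by linarith
  have h5 : ‖M‖ ^ 2 = 0 := by simpa [ht0.ne'] using h4
  exact norm_eq_zero.1 (pow_eq_zero_iff two_ne_zero |>.1 h5)

theorem exists_isMinOn_lqrCost (hQ : Q.PosDef) (hR : R.PosDef)
    (hstab : (stabilizingGains A B).Nonempty) :
    ∃ K ∈ stabilizingGains A B, ∀ L ∈ stabilizingGains A B,
      lqrCost A B Q R K ≤ lqrCost A B Q R L := by
  obtain ⟨K₀, hK₀⟩ := hstab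
  obtain ⟨K, hK, hmin⟩ := (isCompact_setOf_lqrCost_le (A := A) (B := B) hQ hR
    (lqrCost A B Q R K₀)).exists_isMinOn ⟨K₀, hK₀, le_rfl⟩
    ((continuousOn_lqrCost hQ hR).mono fun _ h => h.1)
  refine ⟨K, hK.1, fun L hL => ?_⟩
  rcases le_or_gt (lqrCost A B Q R L) (lqrCost A B Q R K₀) with h | h
  · exact hmin ⟨hL, h⟩
  · exact hK.2.trans h.le

/-- At a minimiser of the cost the natural gradient vanishes, that is `R K = Bᵀ P_K`, and this turns
the Lyapunov equation of `K` into the Riccati equation. -/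
theorem riccatiSolution_spec (hQ : Q.PosDef) (hR : R.PosDef)
    (hstab : (stabilizingGains A B).Nonempty) :
    (riccatiSolution A B Q R).PosDef ∧
      Aᵀ * riccatiSolution A B Q R + riccatiSolution A B Q R * A + Q -
        riccatiSolution A B Q R * B * R⁻¹ * Bᵀ * riccatiSolution A B Q R = 0 := by
  have h : ∃ P : Matrix (Fin n) (Fin n) ℝ,
      P.PosDef ∧ Aᵀ * P + P * A + Q - P * B * R⁻¹ * Bᵀ * P = 0 := by
    obtain ⟨K, hK, hmin⟩ := exists_isMinOn_lqrCost hQ hR hstab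
    have hM := naturalGradient_eq_zero_of_isMinOn hQ hR hK hmin
    have hP := costMatrix_posDef hQ hR hK
    have hE := costMatrix_eq hQ hR hK
    refine ⟨_, hP, ?_⟩
    set P := costMatrix A B Q R K
    have hu : IsUnit R.det := (Matrix.isUnit_iff_isUnit_det R).1 hR.isUnit
    have hRK : R * K = Bᵀ * P := sub_eq_zero.1 hM
    have hKR : Kᵀ * R = P * B := by
      have := congrArg Matrix.transpose hRK
      simpa [Matrix.transpose_mul, hR.transpose_eq, hP.transpose_eq] using this
    have hK' : P * B * R⁻¹ * Bᵀ * P = P * (B * K) := by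
      rw [Matrix.mul_assoc _ Bᵀ, ← hRK, ← Matrix.mul_assoc, Matrix.mul_assoc _ R⁻¹,
        Matrix.nonsing_inv_mul R hu, Matrix.mul_one, Matrix.mul_assoc]
    rw [hK', ← hE, hKR, Matrix.transpose_sub, Matrix.transpose_mul, Matrix.sub_mul, Matrix.mul_sub,
      Matrix.mul_assoc Kᵀ, ← hRK, ← Matrix.mul_assoc Kᵀ, hKR, Matrix.mul_assoc P B]
    abel
  rw [riccatiSolution, dif_pos h]
  exact h.choose_spec

variable (A B Q R) in
theorem mul_optimalGain (hR : R.PosDef) :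
    R * optimalGain A B Q R = Bᵀ * riccatiSolution A B Q R := by
  have hu : IsUnit R.det := (Matrix.isUnit_iff_isUnit_det R).1 hR.isUnit
  rw [optimalGain, ← Matrix.mul_assoc, ← Matrix.mul_assoc, Matrix.mul_nonsing_inv R hu,
    Matrix.one_mul]

/-- Valid for whichever positive definite solution was chosen, so uniqueness for the Riccati
equation is never needed. -/
theorem riccatiSolution_lyapunov (hQ : Q.PosDef) (hR : R.PosDef)
    (hstab : (stabilizingGains A B).Nonempty) :
    (A - B * optimalGain A B Q R)ᵀ * riccatiSolution A B Q R +
      riccatiSolution A B Q R * (A - B * optimalGain A B Q R) +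
      (Q + (optimalGain A B Q R)ᵀ * R * optimalGain A B Q R) = 0 := by
  obtain ⟨hP, hE⟩ := riccatiSolution_spec hQ hR hstab
  have hRK := mul_optimalGain A B Q R hR
  have hK : riccatiSolution A B Q R * B * R⁻¹ * Bᵀ * riccatiSolution A B Q R =
      riccatiSolution A B Q R * (B * optimalGain A B Q R) := by
    simp only [optimalGain, Matrix.mul_assoc]
  set P := riccatiSolution A B Q R
  set K := optimalGain A B Q R
  have hKR : Kᵀ * R = P * B := by
    have := congrArg Matrix.transpose hRK
    simpa [Matrix.transpose_mul, hR.transpose_eq, hP.transpose_eq] using this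
  rw [← hE, hK, hKR, Matrix.transpose_sub, Matrix.transpose_mul, Matrix.sub_mul, Matrix.mul_sub,
    Matrix.mul_assoc Kᵀ, ← hRK, ← Matrix.mul_assoc Kᵀ, hKR, Matrix.mul_assoc P B]
  abel

theorem optimalGain_mem (hQ : Q.PosDef) (hR : R.PosDef)
    (hstab : (stabilizingGains A B).Nonempty) :
    optimalGain A B Q R ∈ stabilizingGains A B := by
  refine isHurwitz_of_lyapunov (riccatiSolution_spec hQ hR hstab).1 ?_
  rw [eq_neg_of_add_eq_zero_left (riccatiSolution_lyapunov hQ hR hstab), neg_neg]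
  exact posDef_add_transpose_mul_mul hQ hR _

theorem costMatrix_optimalGain (hQ : Q.PosDef) (hR : R.PosDef)
    (hstab : (stabilizingGains A B).Nonempty) :
    costMatrix A B Q R (optimalGain A B Q R) = riccatiSolution A B Q R :=
  (eq_costMatrix hQ hR (optimalGain_mem hQ hR hstab)
    (riccatiSolution_lyapunov hQ hR hstab)).symm

theorem optimalY_spec (hQ : Q.PosDef) (hR : R.PosDef)
    (hstab : (stabilizingGains A B).Nonempty) :
    (optimalY A B Q R).PosDef ∧ (A - B * optimalGain A B Q R) * optimalY A B Q R +
      optimalY A B Q R * (A - B * optimalGain A B Q R)ᵀ + 1 = 0 := by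
  have := (IsHurwitz.transpose (optimalGain_mem hQ hR hstab)).lyapunovSolution_spec
    (Matrix.PosDef.one (n := Fin n) (R := ℝ))
  rwa [Matrix.transpose_transpose] at this

/-- The gradient term vanishes at `K*`, so `P*` leaves exactly the residual `Eᵀ R E ≥ 0` in the
equation of `K`; the comparison principle for `A - B K` concludes. -/
theorem riccatiSolution_le_costMatrix (hQ : Q.PosDef) (hR : R.PosDef)
    (hK : K ∈ stabilizingGains A B) :
    (costMatrix A B Q R K - riccatiSolution A B Q R).PosSemidef := by
  have hstab : (stabilizingGains A B).Nonempty := ⟨K, hK⟩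
  obtain ⟨hP, -⟩ := riccatiSolution_spec hQ hR hstab
  have h1 := lyapunov_change_gain hP.transpose_eq hR.transpose_eq
    (riccatiSolution_lyapunov hQ hR hstab) (K - optimalGain A B Q R)
  rw [mul_optimalGain A B Q R hR, sub_self, Matrix.transpose_zero, Matrix.mul_zero,
    Matrix.zero_mul, add_sub_cancel, zero_add, zero_add] at h1
  refine IsHurwitz.posSemidef_of_lyapunov hK ?_
  convert hR.posSemidef.transpose_mul_mul_same (K - optimalGain A B Q R) using 1
  rw [← h1, ← sub_eq_zero, ← neg_eq_zero, ← costMatrix_eq hQ hR hK, Matrix.mul_sub, Matrix.sub_mul]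
  abel

end Regulator

/-! ### The weighted inner product. -/

section InnerY

variable {n m : ℕ} {Y : Matrix (Fin n) (Fin n) ℝ}

theorem innerY_self_nonneg (hY : Y.PosSemidef) (K : Matrix (Fin m) (Fin n) ℝ) :
    0 ≤ innerY Y K K :=
  (hY.mul_mul_transpose_same K).trace_nonneg

theorem innerY_comm (hY : Y.PosSemidef) (K L : Matrix (Fin m) (Fin n) ℝ) :
    innerY Y K L = innerY Y L K := by
  rw [innerY, innerY, ← Matrix.trace_transpose, Matrix.transpose_mul, Matrix.transpose_mul,
    Matrix.transpose_transpose, hY.transpose_eq, Matrix.mul_assoc]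

theorem innerY_add_smul_self (hY : Y.PosSemidef) (K L : Matrix (Fin m) (Fin n) ℝ) (t : ℝ) :
    innerY Y (K + t • L) (K + t • L) =
      innerY Y K K + 2 * t * innerY Y K L + t ^ 2 * innerY Y L L := by
  have h := innerY_comm hY K L
  simp only [innerY, Matrix.transpose_add, Matrix.transpose_smul, Matrix.mul_add, Matrix.add_mul,
    Matrix.mul_smul, Matrix.smul_mul, Matrix.trace_add, Matrix.trace_smul, smul_eq_mul] at h ⊢
  rw [← h]
  ring

theorem innerY_smul_add_left (M W E : Matrix (Fin m) (Fin n) ℝ) (s : ℝ) :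
    innerY Y (s • M + W) E = s * innerY Y M E + innerY Y W E := by
  simp [innerY, Matrix.add_mul]

theorem innerY_self_le_norm_sq (hY : Y.PosSemidef) (W : Matrix (Fin m) (Fin n) ℝ) :
    innerY Y W W ≤ spectralNorm2 Y * ‖W‖ ^ 2 := by
  have := (spectralNorm2_smul_one_sub_posSemidef hY.transpose_eq).trace_mul_le_trace_mul
    (Matrix.posSemidef_transpose_mul_self W)
  rw [Matrix.smul_mul, Matrix.one_mul, Matrix.trace_smul, ← Matrix.frobenius_norm_sq_eq_trace,
    smul_eq_mul] at this
  rwa [innerY, Matrix.mul_assoc, Matrix.trace_mul_comm, Matrix.mul_assoc]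

theorem innerY_self_pos (hY : Y.PosDef) {K : Matrix (Fin m) (Fin n) ℝ} (hK : K ≠ 0) :
    0 < innerY Y K K := by
  obtain ⟨y, hy, hyY⟩ := hY.exists_sub_smul_one_posSemidef
  have := hyY.trace_mul_le_trace_mul (Matrix.posSemidef_transpose_mul_self K)
  rw [Matrix.smul_mul, Matrix.one_mul, Matrix.trace_smul, ← Matrix.frobenius_norm_sq_eq_trace,
    smul_eq_mul, Matrix.trace_mul_comm, Matrix.mul_assoc, Matrix.trace_mul_comm] at this
  refine lt_of_lt_of_le ?_ this
  have := norm_pos_iff.2 hK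
  positivity

end InnerY

/-! ### The one-step decrease estimate. -/

section Regulator

variable {n m : ℕ} {A : Matrix (Fin n) (Fin n) ℝ} {B : Matrix (Fin n) (Fin m) ℝ}
  {Q : Matrix (Fin n) (Fin n) ℝ} {R : Matrix (Fin m) (Fin m) ℝ} {K : Matrix (Fin m) (Fin n) ℝ}

theorem lqrCost_optimalGain_le (hQ : Q.PosDef) (hR : R.PosDef) (hK : K ∈ stabilizingGains A B) :
    lqrCost A B Q R (optimalGain A B Q R) ≤ lqrCost A B Q R K := by
  have := (riccatiSolution_le_costMatrix hQ hR hK).trace_le_trace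
  rwa [← costMatrix_optimalGain hQ hR ⟨K, hK⟩] at this

/-- The natural gradient in the direction of the optimal gain. -/
theorem two_mul_innerY_naturalGradient (hQ : Q.PosDef) (hR : R.PosDef)
    (hK : K ∈ stabilizingGains A B) :
    2 * innerY (optimalY A B Q R) (R * K - Bᵀ * costMatrix A B Q R K)
        (K - optimalGain A B Q R) =
      lqrCost A B Q R K - lqrCost A B Q R (optimalGain A B Q R) +
        innerY (optimalY A B Q R) (R * (K - optimalGain A B Q R)) (K - optimalGain A B Q R) := by
  have hstab : (stabilizingGains A B).Nonempty := ⟨K, hK⟩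
  obtain ⟨hY, hYE⟩ := optimalY_spec hQ hR hstab
  have hP := costMatrix_posDef hQ hR hK
  have h1 := lyapunov_change_gain hP.transpose_eq hR.transpose_eq (costMatrix_eq hQ hR hK)
    (-(K - optimalGain A B Q R))
  have h2 := riccatiSolution_lyapunov hQ hR hstab
  have hcomm := innerY_comm hY.posSemidef (R * K - Bᵀ * costMatrix A B Q R K)
    (K - optimalGain A B Q R)
  rw [show K + -(K - optimalGain A B Q R) = optimalGain A B Q R by abel] at h1
  rw [lqrCost, lqrCost, costMatrix_optimalGain hQ hR hstab]
  set P := costMatrix A B Q R K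
  set P₀ := riccatiSolution A B Q R
  set K₀ := optimalGain A B Q R
  set Y := optimalY A B Q R
  set M := R * K - Bᵀ * P
  set E := K - K₀
  set F := A - B * K₀
  have h3 : Fᵀ * (P - P₀) + (P - P₀) * F = Eᵀ * R * E - (Eᵀ * M + Mᵀ * E) := by
    have : Fᵀ * (P - P₀) + (P - P₀) * F =
        (Fᵀ * P + P * F + (Q + K₀ᵀ * R * K₀)) - (Fᵀ * P₀ + P₀ * F + (Q + K₀ᵀ * R * K₀)) := by
      rw [Matrix.mul_sub, Matrix.sub_mul]; abel
    rw [this, h1, h2, Matrix.transpose_neg]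
    simp only [Matrix.neg_mul, Matrix.mul_neg]
    abel
  -- `Y` solves the adjoint Lyapunov equation with right-hand side `-1`, so pairing with it turns
  -- the matrix identity into one for the cost gap.
  have h4 : ((Fᵀ * (P - P₀) + (P - P₀) * F) * Y).trace = -(P - P₀).trace := by
    have : (Fᵀ * (P - P₀) * Y).trace = ((P - P₀) * (Y * Fᵀ)).trace := by
      rw [Matrix.mul_assoc, Matrix.trace_mul_comm, Matrix.mul_assoc]
    rw [Matrix.add_mul, Matrix.trace_add, this, Matrix.mul_assoc, ← Matrix.trace_add,
      ← Matrix.mul_add, add_comm, eq_neg_of_add_eq_zero_left hYE, Matrix.mul_neg, Matrix.mul_one,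
      Matrix.trace_neg]
  have h5 : ∀ X Z : Matrix (Fin m) (Fin n) ℝ, (Xᵀ * Z * Y).trace = innerY Y Z X := by
    intro X Z
    rw [innerY, Matrix.mul_assoc, Matrix.trace_mul_comm]
  rw [h3, Matrix.sub_mul, Matrix.add_mul, Matrix.trace_sub, Matrix.trace_add, h5, h5,
    Matrix.mul_assoc Eᵀ, h5, ← hcomm, Matrix.trace_sub] at h4
  linarith

theorem innerY_mul_nonneg (hR : R.PosDef) {Y : Matrix (Fin n) (Fin n) ℝ} (hY : Y.PosSemidef)
    (E : Matrix (Fin m) (Fin n) ℝ) : 0 ≤ innerY Y (R * E) E := by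
  rw [innerY, Matrix.mul_assoc, Matrix.mul_assoc, ← Matrix.mul_assoc E]
  exact hR.posSemidef.trace_mul_nonneg (hY.mul_mul_transpose_same E)

theorem mul_innerY_le_innerY_mul {r : ℝ}
    (hrR : (R - r • (1 : Matrix (Fin m) (Fin m) ℝ)).PosSemidef)
    {Y : Matrix (Fin n) (Fin n) ℝ} (hY : Y.PosSemidef) (E : Matrix (Fin m) (Fin n) ℝ) :
    r * innerY Y E E ≤ innerY Y (R * E) E := by
  have := hrR.trace_mul_le_trace_mul (hY.mul_mul_transpose_same E)
  rw [Matrix.smul_mul, Matrix.one_mul, Matrix.trace_smul, smul_eq_mul] at this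
  rwa [innerY, innerY, Matrix.mul_assoc R, Matrix.mul_assoc R]

theorem stepConstant_ge_one (hQ : Q.PosDef) (hR : R.PosDef) (hK : K ∈ stabilizingGains A B) :
    1 ≤ stepConstant A B Q R K :=
  le_add_of_nonneg_right (mul_nonneg (mul_nonneg (spectralNorm2_nonneg _)
    (spectralNorm2_nonneg _)) (lqrCost_nonneg hQ hR hK))

/-- The weighted norm of the natural gradient is controlled by its inner product with the direction
of the optimal gain. -/
theorem innerY_naturalGradient_self_le (hQ : Q.PosDef) (hR : R.PosDef)
    (hK : K ∈ stabilizingGains A B) :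
    innerY (optimalY A B Q R) (R * K - Bᵀ * costMatrix A B Q R K)
        (R * K - Bᵀ * costMatrix A B Q R K) ≤
      2 * spectralNorm2 R * stepConstant A B Q R K *
        (lqrCost A B Q R K - lqrCost A B Q R (optimalGain A B Q R) +
          innerY (optimalY A B Q R) (R * (K - optimalGain A B Q R)) (K - optimalGain A B Q R)) := by
  have hstab : (stabilizingGains A B).Nonempty := ⟨K, hK⟩
  obtain ⟨hY, -⟩ := optimalY_spec hQ hR hstab
  have hD := riccatiSolution_le_costMatrix hQ hR hK
  have hRK := mul_optimalGain A B Q R hR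
  have hc := stepConstant_ge_one hQ hR hK
  have hP0 := (riccatiSolution_spec hQ hR hstab).1.posSemidef.trace_nonneg
  have he := innerY_mul_nonneg hR hY.posSemidef (K - optimalGain A B Q R)
  rw [lqrCost, lqrCost, costMatrix_optimalGain hQ hR hstab]
  have hcdef : stepConstant A B Q R K = 1 + spectralNorm2 (optimalY A B Q R) *
    spectralNorm2 (B * R⁻¹ * Bᵀ) * (costMatrix A B Q R K).trace := rfl
  rw [← Matrix.trace_sub]
  have hTr : (costMatrix A B Q R K - riccatiSolution A B Q R).trace ≤
      (costMatrix A B Q R K).trace := by rw [Matrix.trace_sub]; linarith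
  set c := stepConstant A B Q R K
  set P := costMatrix A B Q R K
  set P₀ := riccatiSolution A B Q R
  set K₀ := optimalGain A B Q R
  set Y := optimalY A B Q R
  set E := K - K₀ with hE
  set D := P - P₀ with hDdef
  -- The gradient is `R (E - H)`. The `H` part is quadratic in the gap `D`; `tr D ≤ tr P_K` makes it
  -- linear, which produces the factor `c(K)`.
  set H := R⁻¹ * (Bᵀ * D) with hH
  have hu : IsUnit R.det := (Matrix.isUnit_iff_isUnit_det R).1 hR.isUnit
  have hRH : R * H = Bᵀ * D := by
    rw [hH, ← Matrix.mul_assoc, Matrix.mul_nonsing_inv R hu, Matrix.one_mul]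
  have hM : R * K - Bᵀ * P = R * (E - H) := by
    rw [Matrix.mul_sub, hRH, hE, Matrix.mul_sub, hRK, hDdef, Matrix.mul_sub]; abel
  have hs := spectralNorm2_nonneg R
  have h1 : innerY Y (R * (E - H)) (R * (E - H)) ≤ spectralNorm2 R *
      innerY Y (R * (E - H)) (E - H) := by
    have := (hR.posSemidef.smul_sub_mul_self
      (spectralNorm2_smul_one_sub_posSemidef hR.transpose_eq)).trace_mul_le_trace_mul
      (hY.posSemidef.mul_mul_transpose_same (E - H))
    rw [Matrix.smul_mul, Matrix.trace_smul, smul_eq_mul, Matrix.mul_assoc,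
      Matrix.trace_mul_comm] at this
    rw [innerY, innerY, Matrix.transpose_mul, hR.transpose_eq]
    simpa only [Matrix.mul_assoc] using this
  have h2 : innerY Y (R * (E - H)) (E - H) ≤
      2 * innerY Y (R * E) E + 2 * innerY Y (R * H) H := by
    have := innerY_mul_nonneg hR hY.posSemidef (E + H)
    simp only [innerY, Matrix.transpose_add, Matrix.transpose_sub, Matrix.mul_add, Matrix.add_mul,
      Matrix.mul_sub, Matrix.sub_mul, Matrix.trace_add, Matrix.trace_sub] at this ⊢
    linarith
  have h3 : innerY Y (R * H) H = (B * R⁻¹ * Bᵀ * (D * Y * Dᵀ)).trace := by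
    rw [innerY, hRH, hH, Matrix.transpose_mul, Matrix.transpose_mul, Matrix.transpose_transpose,
      Matrix.transpose_nonsing_inv, hR.transpose_eq, Matrix.trace_mul_comm (B * R⁻¹ * Bᵀ)]
    rw [Matrix.mul_assoc Bᵀ, Matrix.mul_assoc Bᵀ, Matrix.trace_mul_comm Bᵀ]
    simp only [Matrix.mul_assoc]
  have hBsymm : (B * R⁻¹ * Bᵀ)ᵀ = B * R⁻¹ * Bᵀ := by
    rw [Matrix.transpose_mul, Matrix.transpose_mul, Matrix.transpose_transpose,
      Matrix.transpose_nonsing_inv, hR.transpose_eq, Matrix.mul_assoc]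
  have h4 := (spectralNorm2_smul_one_sub_posSemidef hBsymm).trace_mul_le_trace_mul
    (hY.posSemidef.mul_mul_transpose_same D)
  rw [Matrix.smul_mul, Matrix.one_mul, Matrix.trace_smul, smul_eq_mul] at h4
  have h5 : (D * Y * Dᵀ).trace ≤ spectralNorm2 Y * (D.trace * D.trace) := by
    have h6 := innerY_self_le_norm_sq hY.posSemidef D
    refine h6.trans (mul_le_mul_of_nonneg_left ?_ (spectralNorm2_nonneg _))
    rw [← sq]
    exact pow_le_pow_left₀ (norm_nonneg _) hD.norm_le_trace 2
  have hD0 := hD.trace_nonneg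
  have hb := spectralNorm2_nonneg (B * R⁻¹ * Bᵀ)
  have hy := spectralNorm2_nonneg Y
  have h6 : innerY Y (R * H) H ≤ (c - 1) * D.trace := by
    rw [h3]
    calc _ ≤ spectralNorm2 (B * R⁻¹ * Bᵀ) * (spectralNorm2 Y * (D.trace * D.trace)) :=
          h4.trans (mul_le_mul_of_nonneg_left h5 hb)
      _ ≤ spectralNorm2 (B * R⁻¹ * Bᵀ) * (spectralNorm2 Y * (P.trace * D.trace)) := by gcongr
      _ = (c - 1) * D.trace := by rw [hcdef]; ring
  rw [hM]
  calc _ ≤ spectralNorm2 R * (2 * innerY Y (R * E) E + 2 * ((c - 1) * D.trace)) :=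
        h1.trans (mul_le_mul_of_nonneg_left (by linarith) hs)
    _ ≤ spectralNorm2 R * (2 * (c * (D.trace + innerY Y (R * E) E))) := by
        refine mul_le_mul_of_nonneg_left ?_ hs
        nlinarith [mul_nonneg (sub_nonneg.2 hc) he]
    _ = _ := by ring

/-- One perturbed natural gradient step decreases the Lyapunov function up to a term of the order of
the squared perturbation. -/
theorem naturalLyapunov_step_le (hQ : Q.PosDef) (hR : R.PosDef) (hK : K ∈ stabilizingGains A B)
    {t q r : ℝ} (ht : 0 ≤ t) (htR : t * spectralNorm2 R ≤ 1 / 2)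
    (htc : t * (6 * spectralNorm2 R * stepConstant A B Q R K) ≤ 1) (hq : 0 < q)
    (hqQ : (Q - q • (1 : Matrix (Fin n) (Fin n) ℝ)).PosSemidef) (hr : 0 < r) (hr1 : r ≤ 1)
    (hrR : (R - r • (1 : Matrix (Fin m) (Fin m) ℝ)).PosSemidef)
    (W : Matrix (Fin m) (Fin n) ℝ) (hW : t * ‖W‖ ^ 2 ≤ q) :
    K - t • ((2 : ℝ) • (R * K - Bᵀ * costMatrix A B Q R K) + W) ∈ stabilizingGains A B ∧
    naturalLyapunov A B Q R (K - t • ((2 : ℝ) • (R * K - Bᵀ * costMatrix A B Q R K) + W)) ≤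
      naturalLyapunov A B Q R K - t * (r * naturalLyapunov A B Q R K / 6) +
        t * ‖W‖ ^ 2 * (spectralNorm2 (optimalY A B Q R) * (6 / r + 5 * t) +
          lqrCost A B Q R K / q) := by
  obtain ⟨hL, hPL⟩ := naturalStep_costMatrix hQ hR hK ht
    (half_smul_one_sub_smul_posSemidef hR ht htR) hq hqQ W hW
  refine ⟨hL, ?_⟩
  have hY := (optimalY_spec hQ hR ⟨K, hK⟩).1.posSemidef
  have h1 := two_mul_innerY_naturalGradient hQ hR hK
  have h2 := innerY_naturalGradient_self_le hQ hR hK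
  have h3 := lqrCost_optimalGain_le hQ hR hK
  have hJ : lqrCost A B Q R
      (K - t • ((2 : ℝ) • (R * K - Bᵀ * costMatrix A B Q R K) + W)) ≤
      (1 + t * ‖W‖ ^ 2 / q) * lqrCost A B Q R K := by
    have := hPL.trace_le_trace
    rwa [Matrix.trace_smul, smul_eq_mul] at this
  have he := mul_innerY_le_innerY_mul hrR hY (K - optimalGain A B Q R)
  have hu := innerY_self_nonneg hY (K - optimalGain A B Q R)
  have ho := innerY_self_le_norm_sq hY W
  have hs := spectralNorm2_nonneg R
  rw [naturalLyapunov, naturalLyapunov]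
  rw [show K - t • ((2 : ℝ) • (R * K - Bᵀ * costMatrix A B Q R K) + W) - optimalGain A B Q R =
    (K - optimalGain A B Q R) +
      (-t) • ((2 : ℝ) • (R * K - Bᵀ * costMatrix A B Q R K) + W) by module]
  set J' := lqrCost A B Q R (K - t • ((2 : ℝ) • (R * K - Bᵀ * costMatrix A B Q R K) + W))
  set J := lqrCost A B Q R K
  set J₀ := lqrCost A B Q R (optimalGain A B Q R)
  set Y := optimalY A B Q R
  set E := K - optimalGain A B Q R
  set M := R * K - Bᵀ * costMatrix A B Q R K
  set c := stepConstant A B Q R K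
  rw [innerY_add_smul_self hY, innerY_comm hY E ((2 : ℝ) • M + W),
    innerY_smul_add_left M W E]
  have hN : innerY Y ((2 : ℝ) • M + W) ((2 : ℝ) • M + W) =
      innerY Y W W + 4 * innerY Y W M + 4 * innerY Y M M := by
    rw [add_comm, innerY_add_smul_self hY]; ring
  have h4 := innerY_self_nonneg hY (M + (-2 : ℝ) • W)
  rw [innerY_add_smul_self hY, innerY_comm hY M W] at h4
  have h5 := innerY_self_nonneg hY (W + (r / 6) • E)
  rw [innerY_add_smul_self hY] at h5
  rw [hN]
  set e := innerY Y (R * E) E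
  set u := innerY Y E E
  set p := innerY Y M M
  set o := innerY Y W W
  set z := innerY Y W E
  set v := innerY Y M E
  set s := innerY Y W M
  -- Budget in units of `t a`: the cross term gives `-2`, Young's inequality for `⟨W, E⟩` costs
  -- `1/6`, the quadratic term costs `5/3`. What remains is `-1/6`, and `a ≥ r V` since `r ≤ 1`.
  set a := J - J₀ + e with ha
  have ha0 : 0 ≤ a := by nlinarith
  have hra : r * (u + J - J₀) ≤ a := by nlinarith
  have hz : -(2 * z) ≤ r / 6 * u + 6 / r * o := by
    have h6 : 0 ≤ 6 / r * (o + 2 * (r / 6) * z + (r / 6) ^ 2 * u) :=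
      mul_nonneg (by positivity) h5
    have h7 : 6 / r * (o + 2 * (r / 6) * z + (r / 6) ^ 2 * u) =
      6 / r * o + 2 * z + r / 6 * u := by field_simp
    linarith
  have hp : t * p ≤ a / 3 := by
    have h6 := mul_le_mul_of_nonneg_left h2 ht
    have h7 := mul_le_mul_of_nonneg_right htc ha0
    linarith
  have h8 : t * (-(2 * z)) ≤ t * (a / 6 + 6 / r * o) :=
    mul_le_mul_of_nonneg_left (by nlinarith) ht
  have h9 : t ^ 2 * (o + 4 * s + 4 * p) ≤ t * (5 / 3 * a) + 5 * t ^ 2 * o := by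
    have h10 : t ^ 2 * (o + 4 * s + 4 * p) ≤ t ^ 2 * (5 * o + 5 * p) :=
      mul_le_mul_of_nonneg_left (by linarith) (sq_nonneg t)
    have h11 := mul_le_mul_of_nonneg_left hp ht
    nlinarith
  have h12 : t * (6 / r + 5 * t) * o ≤ t * (6 / r + 5 * t) * (spectralNorm2 Y * ‖W‖ ^ 2) :=
    mul_le_mul_of_nonneg_left ho (by positivity)
  have h13 : t * (r * (u + J - J₀) / 6) ≤ t * (a / 6) :=
    mul_le_mul_of_nonneg_left (by linarith) ht
  have h14 : (1 + t * ‖W‖ ^ 2 / q) * J = J + t * ‖W‖ ^ 2 * (J / q) := by field_simp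
  have h15 : t * (4 * v) = t * (2 * a) := by rw [ha]; linear_combination 2 * t * h1
  rw [h14] at hJ
  linarith

end Regulator

/-- A positive antitone function has a positive continuous antitone minorant. -/
theorem Antitone.exists_continuous_minorant {g : ℝ → ℝ} (hg : Antitone g) (hpos : ∀ s, 0 < g s) :
    ∃ e : ℝ → ℝ, Continuous e ∧ Antitone e ∧ ∀ s, 0 < e s ∧ e s ≤ g s := by
  have hint : ∀ a b, IntervalIntegrable g MeasureTheory.volume a b := fun a b =>
    hg.intervalIntegrable
  have hle : ∀ s : ℝ, s ≤ s + 1 := fun s => by linarith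
  -- The average over `[s, s + 1]` is continuous and lies between `g (s + 1)` and `g s`.
  refine ⟨fun s => ∫ u in s..s + 1, g u, ?_, ?_, fun s => ⟨?_, ?_⟩⟩
  · have h := intervalIntegral.continuous_primitive hint 0
    have : (fun s => ∫ u in s..s + 1, g u) =
        fun s => (∫ u in (0 : ℝ)..s + 1, g u) - ∫ u in (0 : ℝ)..s, g u := by
      ext s
      exact (intervalIntegral.integral_interval_sub_left (hint _ _) (hint _ _)).symm
    rw [this]
    exact (h.comp (continuous_id.add continuous_const)).sub h
  · have hshift : ∀ s, ∫ u in s..s + 1, g u = ∫ u in (0 : ℝ)..1, g (s + u) := fun s => by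
      rw [intervalIntegral.integral_comp_add_left, add_zero]
    intro s s' hs
    simp only [hshift]
    refine intervalIntegral.integral_mono_on zero_le_one ?_ ?_ fun u _ => hg (by linarith)
    · exact (hg.comp_monotone fun a b h => by simpa using h).intervalIntegrable
    · exact (hg.comp_monotone fun a b h => by simpa using h).intervalIntegrable
  · refine lt_of_lt_of_le (hpos (s + 1)) ?_
    have := intervalIntegral.integral_mono_on (hle s) (intervalIntegrable_const
      (c := g (s + 1)) (μ := MeasureTheory.volume)) (hint s (s + 1)) fun u hu => hg hu.2
    simpa using this
  · have := intervalIntegral.integral_mono_on (hle s) (hint s (s + 1)) (intervalIntegrable_const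
      (c := g s) (μ := MeasureTheory.volume)) fun u hu => hg hu.1
    simpa using this

/-! ### From a decrease estimate to small-disturbance ISS. -/

section ISS

variable {E U : Type*} [NormedAddCommGroup E] [NormedAddCommGroup U]

/-- Coercivity of a function whose sublevel sets lie in compact subsets of an open set. -/
theorem tendsto_atTop_of_escapesFrom {S : Set E} (hS : IsOpen S) {V : E → ℝ}
    (hV : ∀ c, ∃ C ⊆ S, IsCompact C ∧ ∀ x ∈ S, V x ≤ c → x ∈ C) {u : ℕ → E}
    (hu : ∀ k, u k ∈ S) (hesc : EscapesFrom S u) :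
    Tendsto (fun k => V (u k)) atTop atTop := by
  refine tendsto_atTop.2 fun c => ?_
  obtain ⟨C, hCS, hC, hCc⟩ := hV c
  suffices h : ∀ᶠ k in atTop, u k ∉ C by
    filter_upwards [h] with k hk
    by_contra! hlt
    exact hk (hCc _ (hu k) hlt.le)
  rcases hesc with ⟨hne, hlim⟩ | hlim
  · rcases C.eq_empty_or_nonempty with rfl | hCne
    · simp
    obtain ⟨x, hx, hmin⟩ := hC.exists_isMinOn hCne
      (Metric.continuous_infDist_pt (frontier S)).continuousOn
    have hpos : 0 < Metric.infDist x (frontier S) := by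
      refine (isClosed_frontier.notMem_iff_infDist_pos hne).1 fun hxf => ?_
      rw [hS.frontier_eq] at hxf
      exact hxf.2 (hCS hx)
    filter_upwards [hlim.eventually_lt_const hpos] with k hk hkC
    exact absurd (hmin hkC) (not_le.2 hk)
  · obtain ⟨b, hb⟩ := hC.isBounded.exists_norm_le
    filter_upwards [hlim.eventually_gt_atTop b] with k hk hkC
    exact absurd (hb _ hkC) (not_le.2 hk)

variable {S : Set E} {x₀ : E} {f : ℕ → E → U → E} {V : E → ℝ} {η : ℕ → E → ℝ} {ρ c δ : ℝ}

theorem IsSizeFunction.nonneg (hV : IsSizeFunction S x₀ V) {x : E} (hx : x ∈ S) : 0 ≤ V x := by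
  rcases eq_or_ne x x₀ with rfl | h
  · exact hV.eq_zero.ge
  · exact (hV.pos x hx h).le

/-- Since `e` is antitone, the exponential factor is nondecreasing in `r`, so the product stays
strictly increasing. The shift `s₀` leaves room for the offset caused by the disturbance. -/
theorem isClassKL_mul_exp {e : ℝ → ℝ} (he : Continuous e) (hanti : Antitone e)
    (hpos : ∀ s, 0 < e s) (hρ : 0 < ρ) (s₀ : ℝ) :
    IsClassKL fun r t => r * Real.exp (-(ρ * e (r + s₀) * t)) := by
  refine ⟨fun t ht => ⟨Continuous.continuousOn (by fun_prop), ?_, by simp⟩,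
    fun r hr => ⟨?_, ?_⟩⟩
  · intro r hr r' hr' hlt
    have hr0 : (0 : ℝ) ≤ r := hr
    have h1 : e (r' + s₀) ≤ e (r + s₀) := hanti (by linarith)
    have h2 : Real.exp (-(ρ * e (r + s₀) * t)) ≤ Real.exp (-(ρ * e (r' + s₀) * t)) := by
      gcongr
    exact mul_lt_mul hlt h2 (Real.exp_pos _) (hr0.trans hlt.le)
  · intro t _ t' _ htt
    have := hpos (r + s₀)
    have h2 : Real.exp (-(ρ * e (r + s₀) * t')) ≤ Real.exp (-(ρ * e (r + s₀) * t)) := by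
      gcongr
    exact mul_le_mul_of_nonneg_left h2 hr
  · have h1 : Tendsto (fun t => ρ * e (r + s₀) * t) atTop atTop :=
      tendsto_id.const_mul_atTop (mul_pos hρ (hpos _))
    simpa using (Real.tendsto_exp_neg_atTop_nhds_zero.comp h1).const_mul r

/-- Small-disturbance ISS from a decrease estimate in which the disturbance enters through its
squared norm. -/
theorem isSmallDisturbanceISS_of_decrease (hV : IsSizeFunction S x₀ V) (hρ : 0 < ρ) (hc : 0 < c)
    (hδ : 0 < δ) {e : ℝ → ℝ} (he : Continuous e) (hanti : Antitone e) (hpos : ∀ s, 0 < e s)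
    (heη : ∀ k, ∀ x ∈ S, e (V x) ≤ η k x) (hηρ : ∀ k, ∀ x ∈ S, η k x * ρ ≤ 1)
    (hstep : ∀ k, ∀ x ∈ S, ∀ w : U, ‖w‖ ^ 2 ≤ δ →
      f k x w ∈ S ∧ V (f k x w) ≤ V x - η k x * (ρ * V x - c * ‖w‖ ^ 2)) :
    IsSmallDisturbanceISS S x₀ f := by
  have hcρ : 0 < c / ρ := div_pos hc hρ
  refine ⟨V, hV, ENNReal.ofReal √δ, ENNReal.ofReal_pos.2 (Real.sqrt_pos.2 hδ),
    _, isClassKL_mul_exp he hanti hpos hρ (c / ρ * δ), fun w => c / ρ * w ^ 2,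
    ⟨Continuous.continuousOn (by fun_prop), fun a ha b hb hab => ?_, by simp⟩, ?_⟩
  · exact mul_lt_mul_of_pos_left (pow_lt_pow_left₀ hab ha.1 two_ne_zero) hcρ
  intro w hbdd hw χ h0 hχ
  set W := ⨆ j, ‖w j‖ with hW
  have hwk : ∀ k, ‖w k‖ ≤ W := le_ciSup hbdd
  have hW0 : 0 ≤ W := (norm_nonneg _).trans (hwk 0)
  have hWδ : W ^ 2 ≤ δ := by
    have h1 := (ENNReal.ofReal_lt_ofReal_iff (Real.sqrt_pos.2 hδ)).1 hw
    rw [← Real.sq_sqrt hδ.le]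
    exact pow_le_pow_left₀ hW0 h1.le 2
  set s := c / ρ * W ^ 2 with hs
  have hsδ : s ≤ c / ρ * δ := mul_le_mul_of_nonneg_left hWδ hcρ.le
  have hρs : ρ * s = c * W ^ 2 := by rw [hs]; field_simp
  -- The trajectory never exceeds the level `V (χ 0) + s`, so `κ` bounds all its step sizes from
  -- below.
  set κ := e (V (χ 0) + c / ρ * δ) with hκ
  have hκ0 : 0 < κ := hpos _
  have hV00 := hV.nonneg h0
  intro k
  change χ k ∈ S ∧ V (χ k) ≤ V (χ 0) * Real.exp (-(ρ * κ * k)) + s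
  induction k with
  | zero =>
    have : 0 ≤ s := by positivity
    refine ⟨h0, ?_⟩
    simp [this]
  | succ k ih =>
    obtain ⟨hk, hle⟩ := ih
    have hwk2 : ‖w k‖ ^ 2 ≤ W ^ 2 := pow_le_pow_left₀ (norm_nonneg _) (hwk k) 2
    obtain ⟨hS, hdec⟩ := hstep k _ hk (w k) (hwk2.trans hWδ)
    rw [← hχ k] at hS hdec
    refine ⟨hS, ?_⟩
    have hexp : Real.exp (-(ρ * κ * k)) ≤ 1 := Real.exp_le_one_iff.2 (by
      have : 0 ≤ ρ * κ * k := by positivity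
      linarith)
    have hκη : κ ≤ η k (χ k) := by
      refine (hanti ?_).trans (heη k _ hk)
      nlinarith
    have hη1 := hηρ k _ hk
    have hη0 : 0 ≤ η k (χ k) := hκ0.le.trans hκη
    have hdec' : V (χ (k + 1)) - s ≤ (1 - η k (χ k) * ρ) * (V (χ k) - s) := by
      have h1 : η k (χ k) * (c * ‖w k‖ ^ 2) ≤ η k (χ k) * (ρ * s) := by
        rw [hρs]; gcongr
      linarith
    have hsplit : Real.exp (-(ρ * κ * ((k + 1 : ℕ) : ℝ))) =
        Real.exp (-(κ * ρ)) * Real.exp (-(ρ * κ * k)) := by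
      rw [← Real.exp_add]; congr 1; push_cast; ring
    have hrhs : 0 ≤ V (χ 0) * Real.exp (-(ρ * κ * k)) := mul_nonneg hV00 (Real.exp_nonneg _)
    rw [hsplit]
    suffices h : V (χ (k + 1)) - s ≤
        Real.exp (-(κ * ρ)) * (V (χ 0) * Real.exp (-(ρ * κ * k))) by linarith
    -- Below the level `s` the trajectory stays below it, because `η ρ ≤ 1`; above it, the excess
    -- contracts by `1 - η ρ ≤ exp (-κ ρ)`.
    rcases le_or_gt (V (χ k) - s) 0 with hneg | hpos'
    · exact (hdec'.trans (mul_nonpos_of_nonneg_of_nonpos (by linarith) hneg)).trans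
        (mul_nonneg (Real.exp_nonneg _) hrhs)
    · have h1 : 1 - η k (χ k) * ρ ≤ Real.exp (-(κ * ρ)) := by
        have := Real.add_one_le_exp (-(κ * ρ))
        have := mul_le_mul_of_nonneg_right hκη hρ.le
        linarith
      exact hdec'.trans (mul_le_mul h1 (by linarith) hpos'.le (Real.exp_nonneg _))

theorem isSmallDisturbanceISSLyapunov_of_decrease (hV : IsSizeFunction S x₀ V) (hρ : 0 < ρ)
    (hc : 0 < c) (hδ : 0 < δ) {e : ℝ → ℝ} (he : Continuous e) (hpos : ∀ s, 0 < e s)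
    (heη : ∀ k, ∀ x ∈ S, e (V x) ≤ η k x)
    (hstep : ∀ k, ∀ x ∈ S, ∀ w : U, ‖w‖ ^ 2 ≤ δ →
      f k x w ∈ S ∧ V (f k x w) ≤ V x - η k x * (ρ * V x - c * ‖w‖ ^ 2)) :
    IsSmallDisturbanceISSLyapunov S x₀ f V := by
  set b := min δ (ρ / (2 * c)) with hb
  have hb0 : 0 < b := lt_min hδ (by positivity)
  -- The factor `s / (1 + s)` is at most both `1` and `s`: the first keeps `‖w‖² ≤ δ`, the second
  -- makes the disturbance term at most half of `ρ V`.
  refine ⟨hV, fun s => √(b * (s / (1 + s))), fun s => e s * (ρ * s / 2),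
    ⟨?_, ?_, by simp⟩, ⟨Continuous.continuousOn (by fun_prop), by simp, fun s hs => ?_⟩, ?_⟩
  · refine ContinuousOn.sqrt (continuousOn_const.mul (continuousOn_id.div
      (continuousOn_const.add continuousOn_id) fun s hs => ?_))
    have : (0 : ℝ) ≤ s := hs
    exact ne_of_gt (by change 0 < 1 + s; linarith)
  · intro s hs s' hs' hlt
    have h0 : (0 : ℝ) ≤ s := hs
    refine Real.sqrt_lt_sqrt (by positivity) (mul_lt_mul_of_pos_left ?_ hb0)
    rw [div_lt_div_iff₀ (by linarith) (by linarith)]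
    linarith
  · have := hpos s
    positivity
  · intro k x w hx hw
    have hVx := hV.nonneg hx
    have hw2 : ‖w‖ ^ 2 ≤ b * (V x / (1 + V x)) := by
      have := pow_le_pow_left₀ (norm_nonneg _) hw 2
      rwa [Real.sq_sqrt (by positivity)] at this
    have h1 : V x / (1 + V x) ≤ 1 := (div_le_one (by linarith)).2 (by linarith)
    have h2 : V x / (1 + V x) ≤ V x := div_le_self hVx (by linarith)
    have h3 : ‖w‖ ^ 2 ≤ δ :=
      (hw2.trans (mul_le_of_le_one_right hb0.le h1)).trans (min_le_left _ _)
    have h4 : c * ‖w‖ ^ 2 ≤ ρ * V x / 2 := by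
      have h5 : ‖w‖ ^ 2 ≤ ρ / (2 * c) * V x :=
        hw2.trans (mul_le_mul (min_le_right _ _) h2 (by positivity) (by positivity))
      calc c * ‖w‖ ^ 2 ≤ c * (ρ / (2 * c) * V x) := by gcongr
        _ = ρ * V x / 2 := by field_simp
    obtain ⟨hS, hdec⟩ := hstep k x hx w h3
    refine ⟨hS, ?_⟩
    have h6 : e (V x) * (ρ * V x / 2) ≤ η k x * (ρ * V x - c * ‖w‖ ^ 2) :=
      mul_le_mul (heη k x hx) (by linarith) (by positivity) ((hpos _).le.trans (heη k x hx))
    linarith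

omit [NormedAddCommGroup E] in
/-- A step size bounded below on the sublevel sets of `V` has a continuous antitone lower bound in
terms of `V`. -/
theorem exists_antitone_stepsize_lower_bound
    (hη : ∀ b, ∃ ε > 0, ∀ k, ∀ x ∈ S, V x ≤ b → ε ≤ η k x) :
    ∃ e : ℝ → ℝ, Continuous e ∧ Antitone e ∧ (∀ s, 0 < e s) ∧
      ∀ k, ∀ x ∈ S, e (V x) ≤ η k x := by
  -- The extra element `1` keeps the infimum meaningful when the sublevel set is empty.
  set T : ℝ → Set ℝ := fun b => insert 1 {y | ∃ k, ∃ x ∈ S, V x ≤ b ∧ η k x = y} with hT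
  have hlow : ∀ b, ∃ ε > 0, ∀ y ∈ T b, ε ≤ y := by
    intro b
    obtain ⟨ε, hε, h⟩ := hη b
    refine ⟨min ε 1, lt_min hε one_pos, ?_⟩
    rintro y (rfl | ⟨k, x, hx, hxb, rfl⟩)
    · exact min_le_right _ _
    · exact (min_le_left _ _).trans (h k x hx hxb)
  have hbdd : ∀ b, BddBelow (T b) := fun b =>
    let ⟨ε, _, h⟩ := hlow b
    ⟨ε, h⟩
  have hanti : Antitone fun b => sInf (T b) := by
    intro b b' hbb
    refine csInf_le_csInf (hbdd b') ⟨1, Set.mem_insert _ _⟩ ?_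
    rintro y (rfl | ⟨k, x, hx, hxb, rfl⟩)
    · exact Set.mem_insert _ _
    · exact Or.inr ⟨k, x, hx, hxb.trans hbb, rfl⟩
  obtain ⟨e, he, hea, hle⟩ := hanti.exists_continuous_minorant fun b => by
    obtain ⟨ε, hε, h⟩ := hlow b
    exact lt_of_lt_of_le hε (le_csInf ⟨1, Set.mem_insert _ _⟩ h)
  exact ⟨e, he, hea, fun s => (hle s).1, fun k x hx =>
    (hle _).2.trans (csInf_le (hbdd _) (Or.inr ⟨k, x, hx, le_rfl, rfl⟩))⟩

end ISS

/-! ### Application to the natural policy gradient. -/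

section Regulator

variable {n m : ℕ} {A : Matrix (Fin n) (Fin n) ℝ} {B : Matrix (Fin n) (Fin m) ℝ}
  {Q : Matrix (Fin n) (Fin n) ℝ} {R : Matrix (Fin m) (Fin m) ℝ}

theorem lqrCost_sub_le_naturalLyapunov (hQ : Q.PosDef) (hR : R.PosDef)
    (hstab : (stabilizingGains A B).Nonempty) (K : Matrix (Fin m) (Fin n) ℝ) :
    lqrCost A B Q R K - lqrCost A B Q R (optimalGain A B Q R) ≤ naturalLyapunov A B Q R K := by
  have := innerY_self_nonneg (optimalY_spec hQ hR hstab).1.posSemidef (K - optimalGain A B Q R)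
  rw [naturalLyapunov]
  linarith

theorem isSizeFunction_naturalLyapunov (hQ : Q.PosDef) (hR : R.PosDef)
    (hstab : (stabilizingGains A B).Nonempty) :
    IsSizeFunction (stabilizingGains A B) (optimalGain A B Q R) (naturalLyapunov A B Q R) where
  continuousOn := by
    refine ContinuousOn.sub (ContinuousOn.add (Continuous.continuousOn ?_)
      (continuousOn_lqrCost hQ hR)) continuousOn_const
    unfold innerY
    fun_prop
  mem := optimalGain_mem hQ hR hstab
  eq_zero := by simp [naturalLyapunov, innerY]
  pos K hK hne := by
    have h1 := lqrCost_optimalGain_le hQ hR hK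
    have h2 := innerY_self_pos (optimalY_spec hQ hR hstab).1 (sub_ne_zero.2 hne)
    rw [naturalLyapunov]
    linarith
  coercive u hu hesc := by
    refine tendsto_atTop_of_escapesFrom isOpen_stabilizingGains (fun c => ?_) hu hesc
    refine ⟨_, fun K hK => hK.1, isCompact_setOf_lqrCost_le hQ hR
      (c + lqrCost A B Q R (optimalGain A B Q R)), fun K hK hKc => ⟨hK, ?_⟩⟩
    have := lqrCost_sub_le_naturalLyapunov hQ hR hstab K
    linarith

theorem exists_naturalLyapunov_decrease (hQ : Q.PosDef) (hR : R.PosDef)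
    (hstab : (stabilizingGains A B).Nonempty)
    {η : ℕ → Matrix (Fin m) (Fin n) ℝ → ℝ}
    (hη : ∀ k, ∀ K ∈ stabilizingGains A B, 0 < η k K ∧
      η k K ≤ min (1 / (2 * spectralNorm2 R))
        (1 / (6 * spectralNorm2 R * stepConstant A B Q R K))) :
    ∃ ρ > 0, ∃ c > 0, ∃ δ > 0, (∀ k, ∀ K ∈ stabilizingGains A B, η k K * ρ ≤ 1) ∧
      ∀ k, ∀ K ∈ stabilizingGains A B, ∀ W : Matrix (Fin m) (Fin n) ℝ, ‖W‖ ^ 2 ≤ δ →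
        naturalGradientStep A B Q R η k K W ∈ stabilizingGains A B ∧
        naturalLyapunov A B Q R (naturalGradientStep A B Q R η k K W) ≤
          naturalLyapunov A B Q R K -
            η k K * (ρ * naturalLyapunov A B Q R K - c * ‖W‖ ^ 2) := by
  have hsize := isSizeFunction_naturalLyapunov hQ hR hstab
  -- The norm vanishes only for `m = 0`; then `1 / 0 = 0` turns the step-size bound into `η ≤ 0`,
  -- contradicting positivity.
  have hs : 0 < spectralNorm2 R := by
    refine lt_of_le_of_ne (spectralNorm2_nonneg R) fun h0 => ?_
    obtain ⟨K, hK⟩ := hstab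
    obtain ⟨h1, h2⟩ := hη 0 K hK
    have := h2.trans (min_le_left _ _)
    rw [← h0] at this
    norm_num at this
    linarith
  obtain ⟨q, hq, hqQ⟩ := hQ.exists_sub_smul_one_posSemidef
  obtain ⟨r, hr, hr1, hrR⟩ : ∃ r : ℝ, 0 < r ∧ r ≤ 1 ∧
      (R - r • (1 : Matrix (Fin m) (Fin m) ℝ)).PosSemidef := by
    obtain ⟨r, hr, hrR⟩ := hR.exists_sub_smul_one_posSemidef
    refine ⟨min r 1, lt_min hr one_pos, min_le_right _ _, ?_⟩
    have h1 : ((r - min r 1) • (1 : Matrix (Fin m) (Fin m) ℝ)).PosSemidef :=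
      Matrix.PosSemidef.one.smul (sub_nonneg.2 (min_le_left _ _))
    convert hrR.add h1 using 1
    module
  set τ := 1 / (2 * spectralNorm2 R) with hτ
  have hτ0 : 0 < τ := by positivity
  have hητ : ∀ k, ∀ K ∈ stabilizingGains A B, η k K ≤ τ := fun k K hK =>
    (hη k K hK).2.trans (min_le_left _ _)
  have hy := spectralNorm2_nonneg (optimalY A B Q R)
  set y := spectralNorm2 (optimalY A B Q R)
  set J₀ := lqrCost A B Q R (optimalGain A B Q R) with hJ₀
  have hJ0 : 0 ≤ J₀ := lqrCost_nonneg hQ hR hsize.mem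
  -- The error contains `J ‖W‖² / q` with `J ≤ V + J₀`. For `‖W‖² ≤ r q / 12` its `V` part uses up
  -- half of the rate `r / 6`, leaving `r / 12`. The bound `q / τ` ensures `t ‖W‖² ≤ q`, and `1 / τ`
  -- ensures `η ρ ≤ 1`.
  refine ⟨min (r / 12) (1 / τ), by positivity, y * (6 / r + 5 * τ) + J₀ / q + 1, by positivity,
    min (q / τ) (r * q / 12), by positivity, fun k K hK => ?_, fun k K hK W hW => ?_⟩
  · calc η k K * min (r / 12) (1 / τ) ≤ τ * (1 / τ) :=
          mul_le_mul (hητ k K hK) (min_le_right _ _) (by positivity) hτ0.le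
      _ = 1 := mul_one_div_cancel hτ0.ne'
  obtain ⟨ht, htmin⟩ := hη k K hK
  have htτ := hητ k K hK
  have hc : 0 < stepConstant A B Q R K :=
    lt_of_lt_of_le one_pos (stepConstant_ge_one hQ hR hK)
  have htR : η k K * spectralNorm2 R ≤ 1 / 2 := by
    have := (le_div_iff₀ (by positivity)).1 htτ
    linarith
  have htc : η k K * (6 * spectralNorm2 R * stepConstant A B Q R K) ≤ 1 :=
    (le_div_iff₀ (by positivity)).1 (htmin.trans (min_le_right _ _))
  have hw0 : 0 ≤ ‖W‖ ^ 2 := by positivity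
  have hW1 : η k K * ‖W‖ ^ 2 ≤ q :=
    calc η k K * ‖W‖ ^ 2 ≤ τ * (q / τ) :=
          mul_le_mul htτ (hW.trans (min_le_left _ _)) hw0 hτ0.le
      _ = q := mul_div_cancel₀ _ hτ0.ne'
  have hW2 : ‖W‖ ^ 2 ≤ r * q / 12 := hW.trans (min_le_right _ _)
  obtain ⟨hmem, hle⟩ := naturalLyapunov_step_le hQ hR hK ht.le htR htc hq hqQ hr hr1 hrR W hW1
  refine ⟨hmem, hle.trans ?_⟩
  have hV0 : 0 ≤ naturalLyapunov A B Q R K := by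
    have h1 := lqrCost_sub_le_naturalLyapunov hQ hR hstab K
    have h2 := lqrCost_optimalGain_le hQ hR hK
    linarith
  have hJV : lqrCost A B Q R K ≤ naturalLyapunov A B Q R K + J₀ := by
    have h1 := lqrCost_sub_le_naturalLyapunov hQ hR hstab K
    linarith
  set V := naturalLyapunov A B Q R K
  set t := η k K
  set w := ‖W‖ ^ 2
  have h1 : y * (6 / r + 5 * t) ≤ y * (6 / r + 5 * τ) := by gcongr
  have h2 : lqrCost A B Q R K / q ≤ V / q + J₀ / q := by rw [← add_div]; gcongr
  have h3 : w * (V / q) ≤ r * V / 12 := by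
    calc w * (V / q) ≤ r * q / 12 * (V / q) := by gcongr
      _ = r * V / 12 := by field_simp
  have h4 : w * (y * (6 / r + 5 * t) + lqrCost A B Q R K / q) ≤
      w * (y * (6 / r + 5 * τ) + J₀ / q + 1) + r * V / 12 := by
    have := mul_le_mul_of_nonneg_left (add_le_add h1 h2) hw0
    linarith
  have h5 : min (r / 12) (1 / τ) * V ≤ r / 12 * V := by gcongr; exact min_le_left _ _
  have h6 := mul_le_mul_of_nonneg_left h4 ht.le
  have h7 := mul_le_mul_of_nonneg_left h5 ht.le
  linarith

end Regulator

theorem mainTheorem4 (n m : ℕ)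
    (A : Matrix (Fin n) (Fin n) ℝ) (B : Matrix (Fin n) (Fin m) ℝ)
    (Q : Matrix (Fin n) (Fin n) ℝ) (R : Matrix (Fin m) (Fin m) ℝ)
    (hQ : Q.PosDef) (hR : R.PosDef)
    (hstab : (stabilizingGains A B).Nonempty)
    (η : ℕ → Matrix (Fin m) (Fin n) ℝ → ℝ)
    (hη : ∀ k, ∀ K ∈ stabilizingGains A B, 0 < η k K ∧
      η k K ≤ min (1 / (2 * spectralNorm2 R))
        (1 / (6 * spectralNorm2 R * stepConstant A B Q R K)))
    (hη_low : ∀ C ⊆ stabilizingGains A B, IsCompact C →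
      ∃ ε > 0, ∀ k, ∀ K ∈ C, ε ≤ η k K) :
    IsSmallDisturbanceISS (stabilizingGains A B) (optimalGain A B Q R)
      (naturalGradientStep A B Q R η) ∧
    IsSmallDisturbanceISSLyapunov (stabilizingGains A B) (optimalGain A B Q R)
      (naturalGradientStep A B Q R η) (naturalLyapunov A B Q R) := by
  obtain ⟨ρ, hρ, c, hc, δ, hδ, hηρ, hstep⟩ := exists_naturalLyapunov_decrease hQ hR hstab hη
  have hsize := isSizeFunction_naturalLyapunov hQ hR hstab
  obtain ⟨e, he, hanti, hpos, heη⟩ := exists_antitone_stepsize_lower_bound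
    (S := stabilizingGains A B) (V := naturalLyapunov A B Q R) (η := η) fun b => by
      obtain ⟨ε, hε, h⟩ := hη_low _ (fun K hK => hK.1) (isCompact_setOf_lqrCost_le hQ hR
        (b + lqrCost A B Q R (optimalGain A B Q R)))
      refine ⟨ε, hε, fun k K hK hKb => h k K ⟨hK, ?_⟩⟩
      have := lqrCost_sub_le_naturalLyapunov hQ hR hstab K
      linarith
  exact ⟨isSmallDisturbanceISS_of_decrease hsize hρ hc hδ he hanti hpos heη hηρ hstep,
    isSmallDisturbanceISSLyapunov_of_decrease hsize hρ hc hδ he hpos heη hstep⟩
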